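/- Let $\mathbb K$ be a field of characteristic zero. For a nonempty finite set $A$ let $\mathcal{SP}(A)$ be the poset of all set partitions of $A$, ordered by refinement, and let $\mathcal Q$ be the family of all posets isomorphic to a product of finitely many posets $\mathcal{SP}(A)$. Every $P\in\mathcal Q$ has a minimum $0_P$ and a maximum $1_P$, and $\mathcal Q$ is closed under intervals and under direct products. Let $\mathcal H(\mathcal Q)$ be the $\mathbb K$-vector space freely generated by the isomorphism classes $\overline P$ of posets $P\in\mathcal Q$, with the product $\overline P\cdot\overline R=\overline{P\times R}$, whose unit is the class of the one-point poset, the coproduct $$\Delta(\overline P)=\sum_{x\in P}\overline{[0_P,x]}\otimes\overline{[x,1_P]},$$ and the counit $\varepsilon(\overline P)=1$ if $P$ has exactly one element, $\varepsilon(\overline P)=0$ otherwise. Let $\mathcal H_{\mathrm{FdB}}=\mathbb K[x_1,x_2,x_3,\dots]$ be the polynomial algebra with the algebra morphisms $\Delta_{\mathrm{FdB}}$ and $\varepsilon$ given on the generators, with $x_0=1$, by $$\Delta_{\mathrm{FdB}}(x_n)=\sum_{m=0}^{n}\frac{(m+1)!}{(n+1)!}\,B_{n+1,m+1}\bigl(1,2!\,x_1,3!\,x_2,\dots,(n-m+1)!\,x_{n-m}\bigr)\otimes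 x_m,\qquad \varepsilon(x_n)=0\quad(n\ge 1),$$ where, for $1\le m\le n$ and $l=n-m+1$, $B_{n,m}$ is the Bell polynomial $$B_{n,m}(y_1,\dots,y_l)=\sum_{\substack{k_1+k_2+\cdots+k_l=m\\ k_1+2k_2+\cdots+lk_l=n}}\frac{n!}{k_1!\cdots k_l!}\Bigl(\frac{y_1}{1!}\Bigr)^{k_1}\cdots\Bigl(\frac{y_l}{l!}\Bigr)^{k_l}.$$ Then $\mathcal H(\mathcal Q)$ and $\mathcal H_{\mathrm{FdB}}$ are Hopf algebras, and there is an isomorphism of Hopf algebras $\mathcal H(\mathcal Q)\to\mathcal H_{\mathrm{FdB}}$ which, for every $n\ge 0$, sends the class $X_n$ of $\mathcal{SP}(\{1,\dots,n+1\})$ to $(n+1)!\,x_n$. -/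

import Mathlib

open scoped TensorProduct

/-! ### Hopf algebra structures given by a coproduct and a counit -/

/-- The linear maps `Δ : A → A ⊗ A` and `ε : A → K` turn the `K`-algebra `A` into a Hopf algebra:
`(A, Δ, ε)` is a coassociative counital coalgebra, `Δ` and `ε` are morphisms of unital algebras,
and there is an antipode. -/
structure IsHopf {K A : Type*} [CommRing K] [Ring A] [Algebra K A]
    (Δ : A →ₗ[K] A ⊗[K] A) (ε : A →ₗ[K] K) : Prop where
  coassoc : TensorProduct.assoc K A A A ∘ₗ Δ.rTensor A ∘ₗ Δ = Δ.lTensor A ∘ₗ Δ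
  rTensor_counit : ε.rTensor A ∘ₗ Δ = TensorProduct.mk K K A 1
  lTensor_counit : ε.lTensor A ∘ₗ Δ = (TensorProduct.mk K A K).flip 1
  counit_one : ε 1 = 1
  counit_mul : ∀ a b, ε (a * b) = ε a * ε b
  comul_one : Δ 1 = 1
  comul_mul : ∀ a b, Δ (a * b) = Δ a * Δ b
  exists_antipode : ∃ S : A →ₗ[K] A,
    LinearMap.mul' K A ∘ₗ S.rTensor A ∘ₗ Δ = Algebra.linearMap K A ∘ₗ ε ∧
    LinearMap.mul' K A ∘ₗ S.lTensor A ∘ₗ Δ = Algebra.linearMap K A ∘ₗ ε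

/-- The coalgebra with coproduct `Δ` and counit `ε`. -/
abbrev IsHopf.coalgebra {K A : Type*} [CommRing K] [Ring A] [Algebra K A]
    {Δ : A →ₗ[K] A ⊗[K] A} {ε : A →ₗ[K] K} (h : IsHopf Δ ε) : Coalgebra K A where
  comul := Δ
  counit := ε
  coassoc := h.coassoc
  rTensor_counit_comp_comul := h.rTensor_counit
  lTensor_counit_comp_comul := h.lTensor_counit

/-- The bialgebra with coproduct `Δ` and counit `ε`, on the given algebra. -/
abbrev IsHopf.bialgebra {K A : Type*} [CommRing K] [Ring A] [Algebra K A]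
    {Δ : A →ₗ[K] A ⊗[K] A} {ε : A →ₗ[K] K} (h : IsHopf Δ ε) : Bialgebra K A :=
  letI := h.coalgebra
  Bialgebra.mk' K A h.counit_one (h.counit_mul _ _) h.comul_one (h.comul_mul _ _)

/-- The Hopf algebra with coproduct `Δ` and counit `ε`, on the given algebra. Its antipode is
the unique linear map satisfying the antipode identities. -/
noncomputable abbrev IsHopf.hopfAlgebra {K A : Type*} [CommRing K] [Ring A] [Algebra K A]
    {Δ : A →ₗ[K] A ⊗[K] A} {ε : A →ₗ[K] K} (h : IsHopf Δ ε) : HopfAlgebra K A :=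
  { h.bialgebra with
    antipode := h.exists_antipode.choose
    mul_antipode_rTensor_comul := h.exists_antipode.choose_spec.1
    mul_antipode_lTensor_comul := h.exists_antipode.choose_spec.2 }

/-! ### Finite posets with a minimum and a maximum, and their isomorphism classes -/

/-- A finite poset with a least and a greatest element. -/
structure BddPoset where
  carrier : Type
  [order : PartialOrder carrier]
  [bounded : BoundedOrder carrier]
  [fintype : Fintype carrier]

namespace BddPoset

instance : CoeSort BddPoset Type := ⟨carrier⟩
instance (P : BddPoset) : PartialOrder P := P.order
instance (P : BddPoset) : BoundedOrder P := P.bounded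
instance (P : BddPoset) : Fintype P := P.fintype

/-- The interval `[x, y]`. -/
noncomputable def interval (P : BddPoset) (x y : P) (h : x ≤ y) : BddPoset :=
  haveI : Fact (x ≤ y) := ⟨h⟩
  letI : Fintype (Set.Icc x y) := Fintype.ofFinite _
  ⟨Set.Icc x y⟩

/-- The direct product, with the componentwise order. -/
def prod (P Q : BddPoset) : BddPoset := ⟨P × Q⟩

/-- The one-point poset. -/
def point : BddPoset := ⟨PUnit⟩

end BddPoset

/-- Product of two isomorphisms of posets. -/
def orderIsoProd {α β γ δ : Type*} [Preorder α] [Preorder β] [Preorder γ] [Preorder δ]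
    (e : α ≃o β) (f : γ ≃o δ) : α × γ ≃o β × δ where
  toEquiv := Equiv.prodCongr e.toEquiv f.toEquiv
  map_rel_iff' := and_congr e.le_iff_le f.le_iff_le

/-- Product of a family of isomorphisms of posets. -/
def orderIsoPi {ι : Type*} {α β : ι → Type*} [∀ i, Preorder (α i)] [∀ i, Preorder (β i)]
    (e : ∀ i, α i ≃o β i) : (∀ i, α i) ≃o ∀ i, β i where
  toEquiv := Equiv.piCongrRight fun i => (e i).toEquiv
  map_rel_iff' := forall_congr' fun i => (e i).le_iff_le

/-- `F` is an interval closed and hereditary (closed under direct products) family of finite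
posets with a minimum and a maximum; it contains the one-point poset. -/
structure IsHereditary (F : BddPoset → Prop) : Prop where
  interval : ∀ (P : BddPoset) (x y : P) (h : x ≤ y), F P → F (P.interval x y h)
  prod : ∀ P Q : BddPoset, F P → F Q → F (P.prod Q)
  point : F BddPoset.point

/-- Isomorphism of posets, as an equivalence relation on a family. -/
def posetSetoid (F : BddPoset → Prop) : Setoid {P : BddPoset // F P} where
  r P Q := Nonempty (P.1 ≃o Q.1)
  iseqv := ⟨fun _ => ⟨OrderIso.refl _⟩, fun ⟨e⟩ => ⟨e.symm⟩, fun ⟨e⟩ ⟨f⟩ => ⟨e.trans f⟩⟩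

/-- The set of isomorphism classes of the posets of a hereditary family. -/
def PosetClass {F : BddPoset → Prop} (_h : IsHereditary F) : Type 1 :=
  Quotient (posetSetoid F)

namespace PosetClass

variable {F : BddPoset → Prop} {h : IsHereditary F}

/-- The isomorphism class of a member of the family. -/
def mk (h : IsHereditary F) (P : BddPoset) (hP : F P) : PosetClass h :=
  Quotient.mk (posetSetoid F) ⟨P, hP⟩

theorem mk_eq {P Q : BddPoset} {hP : F P} {hQ : F Q} (e : P ≃o Q) : mk h P hP = mk h Q hQ :=
  Quotient.sound ⟨e⟩

/-- A function of posets that is invariant under isomorphism, as a function of classes. -/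
def lift {β : Type*} (f : ∀ P : BddPoset, F P → β)
    (hf : ∀ (P Q : BddPoset) (hP : F P) (hQ : F Q), (P ≃o Q) → f P hP = f Q hQ) :
    PosetClass h → β :=
  Quotient.lift (fun P => f P.1 P.2) fun _ _ ⟨e⟩ => hf _ _ _ _ e

/-- The commutative monoid of isomorphism classes: the product is induced by the direct product
of posets, the unit is the class of the one-point poset. -/
instance : CommMonoid (PosetClass h) where
  mul := Quotient.map₂ (fun P Q => ⟨P.1.prod Q.1, h.prod _ _ P.2 Q.2⟩)
    (fun _ _ ⟨e⟩ _ _ ⟨f⟩ => ⟨orderIsoProd e f⟩)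
  one := mk h BddPoset.point h.point
  mul_assoc := by
    rintro ⟨P⟩ ⟨Q⟩ ⟨R⟩
    exact mk_eq (OrderIso.prodAssoc P.1 Q.1 R.1)
  mul_comm := by
    rintro ⟨P⟩ ⟨Q⟩
    exact mk_eq (OrderIso.prodComm (α := P.1) (β := Q.1))
  one_mul := by
    rintro ⟨P⟩
    exact mk_eq
      { Equiv.punitProd P.1 with
        map_rel_iff' := fun {a b} => ⟨fun hab => ⟨trivial, hab⟩, fun hab => hab.2⟩ }
  mul_one := by
    rintro ⟨P⟩
    exact mk_eq
      { Equiv.prodPUnit P.1 with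
        map_rel_iff' := fun {a b} => ⟨fun hab => ⟨hab, trivial⟩, fun hab => hab.1⟩ }

end PosetClass

/-! ### The standard reduced incidence Hopf algebra of a hereditary family -/

/-- The algebra underlying the incidence Hopf algebra: the vector space freely generated by the
isomorphism classes, with the bilinear extension of the product of classes. It is a type synonym
so that it does not inherit the coalgebra structure of a monoid algebra, in which all elements of
the monoid are group-like. -/
def IncidenceAlg (K : Type*) [Field K] {F : BddPoset → Prop} (h : IsHereditary F) :=
  MonoidAlgebra K (PosetClass h)

namespace IncidenceAlg

variable (K : Type*) [Field K] {F : BddPoset → Prop} (h : IsHereditary F)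

noncomputable instance : CommRing (IncidenceAlg K h) :=
  inferInstanceAs (CommRing (MonoidAlgebra K (PosetClass h)))

noncomputable instance : Algebra K (IncidenceAlg K h) :=
  inferInstanceAs (Algebra K (MonoidAlgebra K (PosetClass h)))

/-- The basis of isomorphism classes. -/
noncomputable def basis : Module.Basis (PosetClass h) K (IncidenceAlg K h) :=
  MonoidAlgebra.basis (PosetClass h) K

/-- The basis element given by (the class of) a poset of the family. -/
noncomputable def cls (P : BddPoset) (hP : F P) : IncidenceAlg K h :=
  basis K h (PosetClass.mk h P hP)

/-- The element `∑ x, [0, x] ⊗ [x, 1]`, for `x` running over the poset `P`. -/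
noncomputable def comulPoset (P : BddPoset) (hP : F P) :
    IncidenceAlg K h ⊗[K] IncidenceAlg K h :=
  ∑ x : P, cls K h (P.interval ⊥ x bot_le) (h.interval _ _ _ _ hP) ⊗ₜ[K]
    cls K h (P.interval x ⊤ le_top) (h.interval _ _ _ _ hP)

open Classical in
/-- `1` for a one-point poset and `0` for a larger one. -/
noncomputable def counitPoset (P : BddPoset) : K := if Fintype.card P = 1 then 1 else 0

/-- An isomorphism of posets restricts to intervals. -/
def intervalIso {P Q : BddPoset} (e : P ≃o Q) (x y : P) (hxy : x ≤ y) (x' y' : Q) (hxy' : x' ≤ y')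
    (hx : e x = x') (hy : e y = y') : P.interval x y hxy ≃o Q.interval x' y' hxy' where
  toEquiv := e.toEquiv.subtypeEquiv (by
    subst hx hy
    intro z
    exact ⟨fun hz => ⟨e.monotone hz.1, e.monotone hz.2⟩,
      fun hz => ⟨e.le_iff_le.1 hz.1, e.le_iff_le.1 hz.2⟩⟩)
  map_rel_iff' := fun {a b} => e.le_iff_le (x := a.1) (y := b.1)

theorem comulPoset_congr {P Q : BddPoset} (e : P ≃o Q) (hP : F P) (hQ : F Q) :
    comulPoset K h P hP = comulPoset K h Q hQ := by
  refine Fintype.sum_equiv e.toEquiv _ _ fun x => ?_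
  unfold cls
  rw [PosetClass.mk_eq (intervalIso e ⊥ x bot_le ⊥ (e x) bot_le (map_bot e) rfl),
    PosetClass.mk_eq (intervalIso e x ⊤ le_top (e x) ⊤ le_top rfl (map_top e))]
  rfl

theorem counitPoset_congr {P Q : BddPoset} (e : P ≃o Q) : counitPoset K P = counitPoset K Q := by
  unfold counitPoset
  rw [Fintype.card_congr e.toEquiv]

/-- The coproduct, the linear map with `P ↦ ∑ x, [0, x] ⊗ [x, 1]` on the basis. -/
noncomputable def comul :
    IncidenceAlg K h →ₗ[K] IncidenceAlg K h ⊗[K] IncidenceAlg K h :=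
  (basis K h).constr K
    (PosetClass.lift (comulPoset K h) fun _ _ hP hQ e => comulPoset_congr K h e hP hQ)

/-- The counit, the linear map which on the basis is `1` at the class of the one-point poset and
`0` at all other classes. -/
noncomputable def counit : IncidenceAlg K h →ₗ[K] K :=
  (basis K h).constr K
    (PosetClass.lift (fun P _ => counitPoset K P) fun _ _ _ _ e => counitPoset_congr K e)

theorem comul_cls (P : BddPoset) (hP : F P) : comul K h (cls K h P hP) = comulPoset K h P hP :=
  (basis K h).constr_basis K _ _

theorem counit_cls (P : BddPoset) (hP : F P) : counit K h (cls K h P hP) = counitPoset K P :=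
  (basis K h).constr_basis K _ _

theorem cls_mul_cls (P Q : BddPoset) (hP : F P) (hQ : F Q) :
    cls K h P hP * cls K h Q hQ = cls K h (P.prod Q) (h.prod P Q hP hQ) := by
  refine (MonoidAlgebra.single_mul_single _ _ (1 : K) 1).trans ?_
  rw [one_mul]
  rfl

theorem cls_point : cls K h BddPoset.point h.point = 1 := rfl

end IncidenceAlg

/-! ### The family of finite products of set-partition lattices -/

noncomputable instance (A : Type) : BoundedOrder (Setoid.Partitions A) where
  toOrderTop := inferInstance
  toOrderBot := inferInstance

/-- The order on partitions is refinement. -/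
theorem partitions_le_iff {A : Type} (S T : Setoid.Partitions A) :
    S ≤ T ↔ ∀ B ∈ S.toSet, ∃ C ∈ T.toSet, B ⊆ C := by
  constructor
  · intro h B hB
    obtain ⟨a, ha⟩ := Setoid.nonempty_of_mem_partition S.isPartition hB
    obtain ⟨C, ⟨hC, haC⟩, -⟩ := T.isPartition.2 a
    refine ⟨C, hC, fun b hb => h (x := a) (y := b) (fun D hD haD => ?_) C hC haC⟩
    rwa [(S.isPartition.2 a).unique ⟨hD, haD⟩ ⟨hB, ha⟩]
  · intro h a b hab C hC haC
    obtain ⟨B, ⟨hB, haB⟩, -⟩ := S.isPartition.2 a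
    obtain ⟨D, hD, hBD⟩ := h B hB
    rw [(T.isPartition.2 a).unique ⟨hC, haC⟩ ⟨hD, hBD haB⟩]
    exact hBD (hab B hB haB)

/-- The lattice `SP(A)` of all set partitions of the finite set `A`, ordered by refinement. -/
noncomputable def SP (A : Type) [Finite A] : BddPoset :=
  letI : Fintype (Setoid.Partitions A) :=
    @Fintype.ofFinite _ (Subtype.finite (α := Set (Set A)) (p := Setoid.IsPartition))
  ⟨Setoid.Partitions A⟩

/-- `P` belongs to the family `Q`: it is isomorphic to the cartesian product of a finite number
of lattices `SP(A)`, for nonempty finite sets `A`. -/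
def FamilyQ (P : BddPoset) : Prop :=
  ∃ (ι : Type) (_ : Finite ι) (A : ι → Type) (_ : ∀ i, Finite (A i)) (_ : ∀ i, Nonempty (A i)),
    Nonempty (P ≃o ∀ i, SP (A i))

section Intervals

/-- Coarsenings finer than `T` amount to one equivalence relation on each class of `T`. -/
def setoidIicIso {A : Type} (T : Setoid A) :
    Set.Iic T ≃o ∀ W : Quotient T, Setoid {a : A // Quotient.mk T a = W} where
  toFun U W := U.1.comap Subtype.val
  invFun f :=
    ⟨{ r := fun a b => ∃ W, ∃ (ha : Quotient.mk T a = W) (hb : Quotient.mk T b = W),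
        f W ⟨a, ha⟩ ⟨b, hb⟩
       iseqv :=
        ⟨fun a => ⟨_, rfl, rfl, (f _).refl _⟩,
          fun ⟨W, ha, hb, h⟩ => ⟨W, hb, ha, (f W).symm h⟩,
          fun ⟨W, ha, hb, h⟩ ⟨W', hb', hc, h'⟩ => by
            obtain rfl : W = W' := hb.symm.trans hb'
            exact ⟨W, ha, hc, (f W).trans h h'⟩⟩ },
      fun {a b} ⟨_, ha, hb, _⟩ => Quotient.exact (ha.trans hb.symm)⟩
  left_inv U := by
    refine Subtype.ext (Setoid.ext fun a b => ⟨?_, fun h => ?_⟩)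
    · rintro ⟨W, ha, hb, h⟩
      exact h
    · exact ⟨_, rfl, Quotient.sound (T.symm (U.2 h)), h⟩
  right_inv f := by
    refine funext fun W => Setoid.ext fun a b => ⟨?_, fun h => ⟨W, a.2, b.2, h⟩⟩
    rintro ⟨W', ha, hb, h⟩
    obtain rfl : W = W' := a.2.symm.trans ha
    exact h
  map_rel_iff' := by
    intro U V
    refine ⟨fun h a b hab => ?_, fun h W a b hab => h hab⟩
    exact @h (Quotient.mk T a) ⟨a, rfl⟩ ⟨b, Quotient.sound (T.symm (U.2 hab))⟩ hab

/-- An isomorphism of posets restricts to closed intervals. -/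
def iccCongr {α β : Type*} [Preorder α] [Preorder β] (e : α ≃o β) (x y : α) :
    Set.Icc x y ≃o Set.Icc (e x) (e y) where
  toEquiv := e.toEquiv.subtypeEquiv fun _ =>
    ⟨fun hz => ⟨e.monotone hz.1, e.monotone hz.2⟩,
      fun hz => ⟨e.le_iff_le.1 hz.1, e.le_iff_le.1 hz.2⟩⟩
  map_rel_iff' := fun {a b} => e.le_iff_le (x := a.1) (y := b.1)

/-- An interval of a product is the product of the intervals. -/
def iccPi {ι : Type*} {α : ι → Type*} [∀ i, Preorder (α i)] (x y : ∀ i, α i) :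
    Set.Icc x y ≃o ∀ i, Set.Icc (x i) (y i) where
  toFun z i := ⟨z.1 i, z.2.1 i, z.2.2 i⟩
  invFun z := ⟨fun i => (z i).1, fun i => (z i).2.1, fun i => (z i).2.2⟩
  map_rel_iff' := Iff.rfl

/-- The interval `[S, T]` as an interval below the equivalence relation induced by `T` on the
quotient by `S`. -/
def iccQuotient {A : Type} (S T : Setoid A) (h : S ≤ T) :
    Set.Icc S T ≃o Set.Iic (Setoid.correspondence S ⟨T, h⟩) where
  toEquiv :=
    { toFun := fun U => ⟨Setoid.correspondence S ⟨U.1, U.2.1⟩,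
        (Setoid.correspondence S).monotone (a := ⟨U.1, U.2.1⟩) (b := ⟨T, h⟩) U.2.2⟩
      invFun := fun V => ⟨((Setoid.correspondence S).symm V.1).1,
        ((Setoid.correspondence S).symm V.1).2,
        (Setoid.correspondence S).symm_apply_le.2 V.2⟩
      left_inv := fun U => by simp
      right_inv := fun V => by simp }
  map_rel_iff' := fun {U V} =>
    (Setoid.correspondence S).le_iff_le (x := ⟨U.1, U.2.1⟩) (y := ⟨V.1, V.2.1⟩)

/-- The interval decomposition `[S, T] ≃ ∏_W SP(W / S)`: the product is over the blocks `W` of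
`T`, and `W / S` is the set of blocks of `S` contained in `W`. -/
theorem interval_decomposition {A : Type} [Finite A] (S T : Setoid A) (h : S ≤ T) :
    Nonempty (Set.Icc S T ≃o ∀ W : Quotient (Setoid.correspondence S ⟨T, h⟩),
      SP {B : Quotient S // Quotient.mk (Setoid.correspondence S ⟨T, h⟩) B = W}) :=
  ⟨((iccQuotient S T h).trans (setoidIicIso _)).trans
    (orderIsoPi fun _ => Setoid.Partition.orderIso _)⟩

end Intervals

theorem FamilyQ.interval (P : BddPoset) (x y : P) (h : x ≤ y) (hP : FamilyQ P) :
    FamilyQ (P.interval x y h) := by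
  obtain ⟨ι, _, A, _, _, ⟨e⟩⟩ := hP
  let s : ∀ i, P → Setoid (A i) := fun i z => (Setoid.Partition.orderIso (A i)).symm (e z i)
  have hs : ∀ i, s i x ≤ s i y := fun i =>
    (Setoid.Partition.orderIso (A i)).symm.monotone (e.monotone h i)
  let c : ∀ i, Setoid (Quotient (s i x)) := fun i => Setoid.correspondence _ ⟨s i y, hs i⟩
  refine ⟨Σ i, Quotient (c i), inferInstance,
    fun p => {B : Quotient (s p.1 x) // Quotient.mk (c p.1) B = p.2}, fun _ => inferInstance,
    fun ⟨i, W⟩ => Quotient.inductionOn W fun B => ⟨⟨B, rfl⟩⟩, ⟨?_⟩⟩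
  let e₁ : P.interval x y h ≃o Set.Icc (e x) (e y) := iccCongr e x y
  let e₂ := iccPi (e x) (e y)
  let e₃ := orderIsoPi fun i =>
    (iccCongr (Setoid.Partition.orderIso (A i)).symm (e x i) (e y i)).trans
      (interval_decomposition (s i x) (s i y) (hs i)).some
  exact ((e₁.trans e₂).trans e₃).trans
    { (Equiv.piCurry _).symm with
      map_rel_iff' := fun {a b} => ⟨fun hab i W => hab ⟨i, W⟩, fun hab p => hab p.1 p.2⟩ }

theorem FamilyQ.prod (P Q : BddPoset) (hP : FamilyQ P) (hQ : FamilyQ Q) :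
    FamilyQ (P.prod Q) := by
  obtain ⟨ι, _, A, _, _, ⟨e⟩⟩ := hP
  obtain ⟨κ, _, B, _, _, ⟨f⟩⟩ := hQ
  have hfin : ∀ i, Finite (Sum.elim A B i) := by
    rintro (i | i) <;> dsimp <;> infer_instance
  refine ⟨ι ⊕ κ, inferInstance, Sum.elim A B, hfin, ?_, ⟨?_⟩⟩
  · rintro (i | i) <;> dsimp <;> infer_instance
  · exact (orderIsoProd e f).trans
      { toEquiv := (Equiv.sumPiEquivProdPi fun i => (SP (Sum.elim A B i) : Type)).symm
        map_rel_iff' := fun {a b} =>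
          ⟨fun hab => ⟨fun i => hab (Sum.inl i), fun i => hab (Sum.inr i)⟩,
            fun hab i => by
              cases i with
              | inl i => exact hab.1 i
              | inr i => exact hab.2 i⟩ }

theorem FamilyQ.point : FamilyQ BddPoset.point :=
  ⟨PEmpty, inferInstance, fun _ => PUnit, fun _ => inferInstance, fun _ => inferInstance,
    ⟨{ toFun := fun _ i => i.elim
       invFun := fun _ => PUnit.unit
       right_inv := fun _ => funext fun i => i.elim
       map_rel_iff' := ⟨fun _ => trivial, fun _ i => i.elim⟩ }⟩⟩

/-- The family `Q` is interval closed and hereditary. -/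
theorem familyQ_isHereditary : IsHereditary FamilyQ :=
  ⟨FamilyQ.interval, FamilyQ.prod, FamilyQ.point⟩

/-- The incidence Hopf algebra `H(Q)` (as an algebra). -/
abbrev HQ (K : Type*) [Field K] := IncidenceAlg K familyQ_isHereditary

theorem familyQ_SP (A : Type) [Finite A] [Nonempty A] : FamilyQ (SP A) :=
  ⟨PUnit, inferInstance, fun _ => A, fun _ => inferInstance, fun _ => inferInstance,
    ⟨(OrderIso.funUnique PUnit (SP A)).symm⟩⟩

/-- The class `X_n` of the lattice of partitions of a set with `n + 1` elements. -/
noncomputable def HQ.X (K : Type*) [Field K] (n : ℕ) : HQ K :=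
  IncidenceAlg.cls K familyQ_isHereditary (SP (Fin (n + 1))) (familyQ_SP _)

/-! ### The Faà di Bruno Hopf algebra -/

open scoped Nat in
/-- The (partial exponential) Bell polynomial `B_{n,m}(y_1, …, y_l)` with `l = n - m + 1`, for
`1 ≤ m ≤ n`: the sum over all `k_1, …, k_l` with `∑ k_j = m` and `∑ j * k_j = n` of
`n! / (k_1! ⋯ k_l!) * (y_1 / 1!) ^ k_1 ⋯ (y_l / l!) ^ k_l`. Here `j : Fin (n - m + 1)` stands
for the index `j + 1`, and `k_j ≤ n` follows from the constraints. -/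
noncomputable def bellPoly (K : Type*) [Field K] {A : Type*} [CommRing A] [Algebra K A]
    (n m : ℕ) (y : ℕ → A) : A :=
  ∑ k ∈ Fintype.piFinset (fun _ : Fin (n - m + 1) => Finset.range (n + 1)) with
      ∑ j, k j = m ∧ ∑ j, (j.1 + 1) * k j = n,
    ((n ! : K) / ∏ j, ((k j)! : K)) • ∏ j, (((j.1 + 1)! : K)⁻¹ • y (j.1 + 1)) ^ k j

/-- The algebra `K[x_1, x_2, x_3, …]` underlying the Faà di Bruno Hopf algebra, as a
type synonym that carries no coalgebra structure of its own. -/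
def FdB (K : Type*) [Field K] := MvPolynomial ℕ+ K

namespace FdB

variable (K : Type*) [Field K]

noncomputable instance : CommRing (FdB K) := inferInstanceAs (CommRing (MvPolynomial ℕ+ K))

noncomputable instance : Algebra K (FdB K) := inferInstanceAs (Algebra K (MvPolynomial ℕ+ K))

/-- The generator `x_n`, with the convention `x_0 = 1`. -/
noncomputable def x (n : ℕ) : FdB K := if h : 0 < n then (MvPolynomial.X ⟨n, h⟩ : MvPolynomial ℕ+ K) else 1

open scoped Nat in
/-- The coproduct, the morphism of algebras given on the generators by
`x_n ↦ ∑_{m=0}^n (m+1)!/(n+1)! B_{n+1,m+1}(1, 2! x_1, …, (n-m+1)! x_{n-m}) ⊗ x_m`. -/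
noncomputable def comul : FdB K →ₐ[K] FdB K ⊗[K] FdB K :=
  show MvPolynomial ℕ+ K →ₐ[K] FdB K ⊗[K] FdB K from MvPolynomial.aeval fun n : ℕ+ =>
    ∑ m ∈ Finset.range (n + 1), (((m + 1)! : K) / ((n + 1)! : K)) •
      (bellPoly K (n + 1) (m + 1) (fun j => (j ! : K) • x K (j - 1)) ⊗ₜ[K] x K m)

/-- The counit, the morphism of algebras with `x_n ↦ 0` for `n ≥ 1`. -/
noncomputable def counit : FdB K →ₐ[K] K :=
  show MvPolynomial ℕ+ K →ₐ[K] K from MvPolynomial.aeval fun _ => 0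

end FdB

/-! Two facts carry the theorem. Unique factorization: a poset in the family determines the sizes
greater than one of the sets `A i` in any decomposition into partition lattices. Hence `HQ K` is a
polynomial algebra on the classes X_1, X_2, … (X_0 is the unit), and X_n ↦ (n+1)! x_n is an
isomorphism of algebras in characteristic zero. Counting: for a partition S of an (n+1)-set, [⊥, S]
is the product of the partition lattices of the blocks of S, and [S, ⊤] is the partition lattice of
the set of blocks. Grouping by the number of blocks turns Δ(X_n) into ∑ B_{n+1,m+1}(X_0, X_1, …) ⊗
X_m, which is the Faà di Bruno formula after rescaling.

Factorization is read off the coatoms, through the relation `Coatom.Rel`. The coatoms of a partition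
lattice are the bipartitions, and any two are related; coatoms from different factors of a product
never are. So the relation counts the factors with a given number 2^(k-1) - 1 of coatoms
(`coatomCount_pi`, `card_eq_card_of_orderIso`). The Bell count `sum_setoid_eq_bellPoly` replaces
partitions into m blocks by surjections onto m points and applies the multinomial theorem.

The incidence algebra of any hereditary family is a Hopf algebra: the convolution unit minus the
identity is locally nilpotent, so its geometric series inverts the identity. The Hopf axioms on the
polynomial side are transported along the isomorphism (`IsHopf.of_algEquiv`). -/

namespace BddPoset

/-! ### Intervals of bounded posets. -/

/-- The underlying element of an element of an interval. -/
noncomputable def intervalVal {P : BddPoset} {x y : P} {h : x ≤ y} (z : P.interval x y h) : P :=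
  (show Set.Icc x y from z).1

/-- An element between `x` and `y`, as an element of the interval. -/
noncomputable def intervalMk {P : BddPoset} {x y : P} (h : x ≤ y) (z : P) (hx : x ≤ z) (hy : z ≤ y) :
    P.interval x y h :=
  (⟨z, hx, hy⟩ : Set.Icc x y)

/-- An interval of an interval is an interval. -/
noncomputable def intervalIntervalIso {P : BddPoset} {x y : P} {h : x ≤ y} (u v : P.interval x y h) (huv : u ≤ v)
    (u' v' : P) (hu : intervalVal u = u') (hv : intervalVal v = v') (h' : u' ≤ v') :
    (P.interval x y h).interval u v huv ≃o P.interval u' v' h' where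
  toFun z := intervalMk h' (intervalVal (intervalVal z)) (hu ▸ z.2.1) (hv ▸ z.2.2)
  invFun z := intervalMk huv
    (intervalMk h (intervalVal z) (u.2.1.trans (hu.trans_le z.2.1))
      ((z.2.2.trans hv.ge).trans v.2.2))
    (hu.trans_le z.2.1) (z.2.2.trans hv.ge)
  map_rel_iff' := Iff.rfl

/-- The whole poset as an interval. -/
noncomputable def intervalBotTopIso (P : BddPoset) : P.interval ⊥ ⊤ bot_le ≃o P where
  toFun := intervalVal
  invFun z := intervalMk _ z bot_le le_top
  map_rel_iff' := Iff.rfl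

/-- An interval of a product is the product of the intervals. -/
noncomputable def intervalProdIso {P Q : BddPoset} (z w : P.prod Q) (h : z ≤ w) (x x' : P) (y y' : Q)
    (hz : z = (x, y)) (hw : w = (x', y')) (hx : x ≤ x') (hy : y ≤ y') :
    (P.prod Q).interval z w h ≃o (P.interval x x' hx).prod (Q.interval y y' hy) where
  toFun t := (intervalMk hx (intervalVal t).1 (by subst hz; exact t.2.1.1)
      (by subst hw; exact t.2.2.1),
    intervalMk hy (intervalVal t).2 (by subst hz; exact t.2.1.2) (by subst hw; exact t.2.2.2))
  invFun t := intervalMk h (intervalVal t.1, intervalVal t.2)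
    (by subst hz; exact ⟨t.1.2.1, t.2.2.1⟩) (by subst hw; exact ⟨t.1.2.2, t.2.2.2⟩)
  map_rel_iff' := Iff.rfl

theorem card_interval_eq_one {P : BddPoset} {x y : P} (h : x ≤ y) :
    Fintype.card (P.interval x y h) = 1 ↔ x = y := by
  rw [Fintype.card_eq_one_iff]
  constructor
  · rintro ⟨z, hz⟩
    exact congrArg intervalVal ((hz (intervalMk h x le_rfl h)).trans
      (hz (intervalMk h y h le_rfl)).symm)
  · rintro rfl
    exact ⟨intervalMk h x le_rfl le_rfl, fun z => Subtype.ext (le_antisymm z.2.2 z.2.1)⟩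

theorem intervalVal_injective {P : BddPoset} {x y : P} (h : x ≤ y) :
    Function.Injective (intervalVal : P.interval x y h → P) :=
  fun _ _ hab => Subtype.ext hab

/-- The inclusion into `P` misses `⊤`. This strict decrease drives the nilpotency induction behind
the antipode. -/
theorem card_interval_bot_lt {P : BddPoset} {x : P} (hx : x ≠ ⊤) :
    Fintype.card (P.interval ⊥ x bot_le) < Fintype.card P :=
  Fintype.card_lt_of_injective_of_notMem intervalVal (intervalVal_injective _) (b := ⊤)
    fun ⟨z, hz⟩ => hx (top_le_iff.1 (hz.symm.trans_le z.2.2))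

theorem card_interval_le {P : BddPoset} {x y : P} (h : x ≤ y) :
    Fintype.card (P.interval x y h) ≤ Fintype.card P :=
  Fintype.card_le_of_injective intervalVal (intervalVal_injective _)

theorem card_pos (P : BddPoset) : 0 < Fintype.card P := Fintype.card_pos_iff.2 ⟨⊥⟩

end BddPoset

/-! ### Bialgebra axioms for the incidence algebra. -/

namespace IncidenceAlg

open BddPoset

variable (K : Type*) [Field K] {F : BddPoset → Prop} (h : IsHereditary F)

theorem cls_congr {P Q : BddPoset} (e : P ≃o Q) (hP : F P) (hQ : F Q) :
    cls K h P hP = cls K h Q hQ := by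
  rw [cls, PosetClass.mk_eq e, cls]

variable {K h}

theorem linearMap_ext {M : Type*} [AddCommMonoid M] [Module K M] {f g : IncidenceAlg K h →ₗ[K] M}
    (hfg : ∀ P hP, f (cls K h P hP) = g (cls K h P hP)) : f = g :=
  (basis K h).ext <| by rintro ⟨P, hP⟩; exact hfg P hP

variable (K h)

open Classical in
theorem counit_cls_interval {P : BddPoset} {x y : P} (hxy : x ≤ y) (hP) :
    counit K h (cls K h (P.interval x y hxy) hP) = if x = y then 1 else 0 := by
  rw [counit_cls, counitPoset]
  exact if_congr (card_interval_eq_one hxy) rfl rfl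

/-- The splitting points of a product are pairs of splitting points, and the intervals they cut off
are products of intervals. -/
theorem comul_cls_mul (P Q : BddPoset) (hP : F P) (hQ : F Q) :
    comul K h (cls K h P hP * cls K h Q hQ) =
      comul K h (cls K h P hP) * comul K h (cls K h Q hQ) := by
  rw [cls_mul_cls, comul_cls, comul_cls, comul_cls, comulPoset, comulPoset, comulPoset,
    Fintype.sum_mul_sum, ← Fintype.sum_prod_type']
  refine Fintype.sum_congr _ _ fun z => ?_
  rw [Algebra.TensorProduct.tmul_mul_tmul, cls_mul_cls, cls_mul_cls]
  congr 1
  · exact cls_congr K h (intervalProdIso _ _ _ _ _ _ _ rfl rfl _ _) _ _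
  · exact cls_congr K h (intervalProdIso _ _ _ _ _ _ _ rfl rfl _ _) _ _

theorem comul_mul (a b : IncidenceAlg K h) :
    comul K h (a * b) = comul K h a * comul K h b := by
  have : (LinearMap.mul K (IncidenceAlg K h)).compr₂ (comul K h) =
      (LinearMap.mul K _).compl₁₂ (comul K h) (comul K h) :=
    linearMap_ext fun P hP => linearMap_ext fun Q hQ => comul_cls_mul K h P Q hP hQ
  exact LinearMap.congr_fun₂ this a b

theorem counit_mul (a b : IncidenceAlg K h) :
    counit K h (a * b) = counit K h a * counit K h b := by
  have : (LinearMap.mul K (IncidenceAlg K h)).compr₂ (counit K h) =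
      (LinearMap.mul K _).compl₁₂ (counit K h) (counit K h) := by
    refine linearMap_ext fun P hP => linearMap_ext fun Q hQ => ?_
    change counit K h (cls K h P hP * cls K h Q hQ) =
      counit K h (cls K h P hP) * counit K h (cls K h Q hQ)
    rw [cls_mul_cls, counit_cls, counit_cls, counit_cls]
    have hc : Fintype.card (P.prod Q) = Fintype.card P * Fintype.card Q := Fintype.card_prod P Q
    simp only [counitPoset, hc, mul_eq_one]
    split_ifs <;> simp_all
  exact LinearMap.congr_fun₂ this a b

theorem comul_one : comul K h 1 = 1 := by
  rw [← cls_point, comul_cls, comulPoset]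
  have : Unique BddPoset.point := inferInstanceAs (Unique PUnit)
  rw [Fintype.sum_unique, Algebra.TensorProduct.one_def, ← cls_point]
  have e (x y : BddPoset.point) (hxy : x ≤ y) : BddPoset.point.interval x y hxy ≃o point :=
    { toFun := fun _ => default
      invFun := fun _ => intervalMk hxy x le_rfl hxy
      left_inv := fun _ => Subtype.ext (Subsingleton.elim _ _)
      right_inv := fun _ => Subsingleton.elim _ _
      map_rel_iff' := fun {a b} =>
        ⟨fun _ => (Subsingleton.elim (intervalVal a) (intervalVal b)).le, fun _ => le_rfl⟩ }
  congr 1 <;> exact cls_congr K h (e _ _ _) _ _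

theorem counit_one : counit K h 1 = 1 := by
  rw [← cls_point, counit_cls, counitPoset, if_pos]
  exact Fintype.card_punit

/-- Both sides sum [⊥, y] ⊗ [y, x] ⊗ [x, ⊤] over all pairs y ≤ x; they differ only in which of the
two elements is chosen first. -/
theorem comul_coassoc :
    TensorProduct.assoc K (IncidenceAlg K h) (IncidenceAlg K h) (IncidenceAlg K h) ∘ₗ
        (comul K h).rTensor (IncidenceAlg K h) ∘ₗ comul K h =
      (comul K h).lTensor _ ∘ₗ comul K h := by
  refine linearMap_ext fun P hP => ?_
  simp only [LinearMap.comp_apply, comul_cls, comulPoset, map_sum, LinearMap.rTensor_tmul,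
    LinearMap.lTensor_tmul, TensorProduct.sum_tmul, TensorProduct.tmul_sum,
    LinearEquiv.coe_coe, TensorProduct.assoc_tmul]
  rw [Finset.sum_sigma', Finset.sum_sigma']
  refine Finset.sum_bij'
    (fun p _ => ⟨intervalVal p.2, intervalMk _ p.1 p.2.2.2 le_top⟩)
    (fun p _ => ⟨intervalVal p.2, intervalMk _ p.1 bot_le p.2.2.1⟩)
    (fun _ _ => by simp) (fun _ _ => by simp)
    (fun _ _ => rfl) (fun _ _ => rfl) fun p _ => ?_
  congr 1
  · exact cls_congr K h (intervalIntervalIso _ _ _ _ _ rfl rfl _) _ _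
  congr 1
  -- The middle factor sits inside [⊥, x] on one side and inside [y, ⊤] on the other; both are
  -- compared with [y, x] in `P`.
  · exact cls_congr K h ((intervalIntervalIso p.2 ⊤ le_top (intervalVal p.2) p.1 rfl rfl
        p.2.2.2).trans
      (intervalIntervalIso ⊥ (intervalMk le_top p.1 p.2.2.2 le_top) bot_le
        (intervalVal p.2) p.1 rfl rfl _).symm) _ _
  · exact cls_congr K h (intervalIntervalIso (intervalMk le_top p.1 p.2.2.2 le_top) ⊤ le_top
        p.1 ⊤ rfl rfl _).symm _ _

theorem rTensor_counit_comul :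
    (counit K h).rTensor _ ∘ₗ comul K h = TensorProduct.mk K K _ 1 := by
  classical
  refine linearMap_ext fun P hP => ?_
  simp only [LinearMap.comp_apply, comul_cls, comulPoset, map_sum, LinearMap.rTensor_tmul,
    counit_cls_interval]
  rw [Fintype.sum_eq_single ⊥ fun x hx => by rw [if_neg hx.symm, TensorProduct.zero_tmul],
    if_pos rfl, cls_congr K h (intervalBotTopIso P) _ hP]
  rfl

theorem lTensor_counit_comul :
    (counit K h).lTensor _ ∘ₗ comul K h = (TensorProduct.mk K _ K).flip 1 := by
  classical
  refine linearMap_ext fun P hP => ?_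
  simp only [LinearMap.comp_apply, comul_cls, comulPoset, map_sum, LinearMap.lTensor_tmul,
    counit_cls_interval]
  rw [Fintype.sum_eq_single ⊤ fun x hx => by rw [if_neg hx, TensorProduct.tmul_zero],
    if_pos rfl, cls_congr K h (intervalBotTopIso P) _ hP]
  rfl

/-- The coalgebra structure of the incidence Hopf algebra. -/
noncomputable abbrev coalgebra : Coalgebra K (IncidenceAlg K h) where
  comul := comul K h
  counit := counit K h
  coassoc := comul_coassoc K h
  rTensor_counit_comp_comul := rTensor_counit_comul K h
  lTensor_counit_comp_comul := lTensor_counit_comul K h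

/-! ### The antipode as a geometric series for convolution. -/

section Antipode

attribute [local instance] coalgebra

open WithConv

/-- The convolution algebra of linear endomorphisms. -/
abbrev Conv := WithConv (IncidenceAlg K h →ₗ[K] IncidenceAlg K h)

theorem conv_mul_cls (f g : Conv K h) (P : BddPoset) (hP : F P) :
    (f * g) (cls K h P hP) =
      ∑ x : P, f (cls K h (P.interval ⊥ x bot_le) (h.interval _ _ _ _ hP)) *
        g (cls K h (P.interval x ⊤ le_top) (h.interval _ _ _ _ hP)) := by
  rw [LinearMap.convMul_apply]
  change LinearMap.mul' K _ (TensorProduct.map _ _ (comul K h _)) = _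
  rw [comul_cls, comulPoset, map_sum, map_sum]
  rfl

/-- The difference of the convolution unit and the identity. -/
noncomputable def unitSubId : Conv K h := 1 - toConv LinearMap.id

theorem cls_of_card_eq_one (P : BddPoset) (hP : F P) (hc : Fintype.card P = 1) :
    cls K h P hP = 1 := by
  rw [← cls_point]
  have := Fintype.card_le_one_iff_subsingleton.1 hc.le
  exact cls_congr K h
    { toFun := fun _ => PUnit.unit
      invFun := fun _ => ⊥
      left_inv := fun _ => Subsingleton.elim _ _
      right_inv := fun _ => rfl
      map_rel_iff' := fun {a b} => ⟨fun _ => (Subsingleton.elim a b).le, fun _ => trivial⟩ } _ _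

theorem conv_one_cls (P : BddPoset) (hP : F P) :
    (1 : Conv K h) (cls K h P hP) = algebraMap K _ (counitPoset K P) := by
  rw [← counit_cls K h P hP]
  rfl

theorem unitSubId_cls (P : BddPoset) (hP : F P) :
    unitSubId K h (cls K h P hP) = algebraMap K _ (counitPoset K P) - cls K h P hP := by
  rw [← conv_one_cls]
  rfl

/-- `unitSubId` kills one-point posets, so a nonzero term of the `k`-th convolution power needs a
chain of `k` strict steps in `P`, hence more than `k` elements. -/
theorem unitSubId_pow_cls (k : ℕ) (P : BddPoset) (hP : F P) (hk : Fintype.card P ≤ k) :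
    (unitSubId K h ^ k) (cls K h P hP) = 0 := by
  induction k generalizing P with
  | zero => exact absurd P.card_pos (by omega)
  | succ k ih =>
    rw [pow_succ, conv_mul_cls]
    refine Finset.sum_eq_zero fun x _ => ?_
    by_cases hx : x = ⊤
    · have hc := (card_interval_eq_one (P := P) (x := x) le_top).2 hx
      rw [unitSubId_cls, counitPoset, if_pos hc, cls_of_card_eq_one K h _ _ hc, map_one, sub_self,
        mul_zero]
    · rw [ih _ _ (by have := card_interval_bot_lt hx; omega), zero_mul]

/-- Partial sums of the geometric series of `unitSubId`. -/
noncomputable def geomSum (n : ℕ) : Conv K h := ∑ k ∈ Finset.range n, unitSubId K h ^ k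

theorem geomSum_cls (n : ℕ) (P : BddPoset) (hP : F P) :
    geomSum K h n (cls K h P hP) = ∑ k ∈ Finset.range n, (unitSubId K h ^ k) (cls K h P hP) := by
  unfold geomSum
  induction n with
  | zero => rfl
  | succ n ih => rw [Finset.sum_range_succ, Finset.sum_range_succ, ← ih]; rfl

/-- Later terms vanish, so the truncation at the size of `P` also serves every interval of `P` at
once. -/
theorem geomSum_cls_of_le {n : ℕ} (P : BddPoset) (hP : F P) (hn : Fintype.card P ≤ n) :
    geomSum K h n (cls K h P hP) = geomSum K h (Fintype.card P) (cls K h P hP) := by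
  rw [geomSum_cls, geomSum_cls]
  refine (Finset.sum_subset (Finset.range_subset_range.2 hn) fun k _ hk => ?_).symm
  exact unitSubId_pow_cls K h k P hP (by simpa using hk)

/-- The antipode, as a locally finite geometric series. -/
noncomputable def antipode : IncidenceAlg K h →ₗ[K] IncidenceAlg K h :=
  (basis K h).constr K (PosetClass.lift (fun P hP => geomSum K h (Fintype.card P) (cls K h P hP))
    fun P Q hP hQ e => by rw [cls_congr K h e hP hQ, Fintype.card_congr e.toEquiv])

theorem antipode_cls {n : ℕ} (P : BddPoset) (hP : F P) (hn : Fintype.card P ≤ n) :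
    antipode K h (cls K h P hP) = geomSum K h n (cls K h P hP) :=
  ((basis K h).constr_basis K _ _).trans (geomSum_cls_of_le K h P hP hn).symm

theorem toConv_id : toConv LinearMap.id = 1 - unitSubId K h := (sub_sub_cancel _ _).symm

theorem one_sub_pow_cls (P : BddPoset) (hP : F P) :
    ((1 : Conv K h) - unitSubId K h ^ Fintype.card P) (cls K h P hP) =
      (1 : Conv K h) (cls K h P hP) :=
  (congrArg ((1 : Conv K h) (cls K h P hP) - ·) (unitSubId_pow_cls K h _ P hP le_rfl)).trans
    (sub_zero _)

theorem antipode_conv_id : toConv (antipode K h) * toConv LinearMap.id = 1 := by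
  refine congrArg toConv (linearMap_ext (f := (toConv (antipode K h) * toConv LinearMap.id).ofConv)
    (g := (1 : Conv K h).ofConv) fun P hP => ?_)
  change ((toConv (antipode K h) * toConv LinearMap.id : Conv K h)) (cls K h P hP) = (1 : Conv K h) _
  -- On `P` the unit may be replaced by 1 - u^n with u = `unitSubId` and n the size of `P`; this
  -- telescopes to the partial geometric sum times 1 - u, and 1 - u is the identity map.
  rw [← one_sub_pow_cls, ← geom_sum_mul_neg, ← toConv_id]
  change _ = (geomSum K h (Fintype.card P) * _) _
  rw [conv_mul_cls, conv_mul_cls]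
  exact Finset.sum_congr rfl fun x _ =>
    congrArg (· * _) (antipode_cls K h _ _ (card_interval_le _))

theorem id_conv_antipode : toConv LinearMap.id * toConv (antipode K h) = 1 := by
  refine congrArg toConv (linearMap_ext (f := (toConv LinearMap.id * toConv (antipode K h)).ofConv)
    (g := (1 : Conv K h).ofConv) fun P hP => ?_)
  change ((toConv LinearMap.id * toConv (antipode K h) : Conv K h)) (cls K h P hP) = (1 : Conv K h) _
  rw [← one_sub_pow_cls, ← mul_neg_geom_sum, ← toConv_id]
  change _ = (_ * geomSum K h (Fintype.card P)) _
  rw [conv_mul_cls, conv_mul_cls]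
  exact Finset.sum_congr rfl fun x _ =>
    congrArg (_ * ·) (antipode_cls K h _ _ (card_interval_le _))

end Antipode

/-- The incidence Hopf algebra of a hereditary family is a Hopf algebra. -/
theorem isHopf : IsHopf (comul K h) (counit K h) where
  coassoc := comul_coassoc K h
  rTensor_counit := rTensor_counit_comul K h
  lTensor_counit := lTensor_counit_comul K h
  counit_one := counit_one K h
  counit_mul := counit_mul K h
  comul_one := comul_one K h
  comul_mul := comul_mul K h
  exists_antipode := by
    let := coalgebra K h
    refine ⟨antipode K h, ?_, ?_⟩
    · exact congrArg WithConv.ofConv (antipode_conv_id K h)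
    · exact congrArg WithConv.ofConv (id_conv_antipode K h)

end IncidenceAlg

/-! ### Counting set partitions by Bell polynomials -/

section Bell

open Finset
open scoped Nat

/-- A sum over functions of an expression in the sizes of the fibres. -/
theorem sum_fiber_card {α ι M : Type*} [Fintype α] [Fintype ι] [DecidableEq ι] [DecidableEq α]
    [AddCommMonoid M] (Φ : (ι → ℕ) → M) :
    ∑ f : α → ι, Φ (fun i => #{a | f a = i}) =
      ∑ k ∈ piAntidiag univ (Fintype.card α), Nat.multinomial univ k • Φ k := by
  -- `L` replaces each monomial by the value of `Φ` at its exponent vector. The claim is `L` applied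
  -- to two expansions of (∑ X_i)^|α|: over functions, and by the multinomial theorem.
  let L : MvPolynomial ι ℕ →ₗ[ℕ] M :=
    (MvPolynomial.basisMonomials ι ℕ).constr ℕ fun s => Φ s
  have hL (k : ι → ℕ) : L (∏ i, MvPolynomial.X i ^ k i) = Φ k := by
    have : (∏ i, MvPolynomial.X i ^ k i : MvPolynomial ι ℕ) =
        MvPolynomial.basisMonomials ι ℕ (Finsupp.equivFunOnFinite.symm k) := by
      refine Eq.trans ?_ (MvPolynomial.monomial_eq (a := 1)).symm
      rw [map_one, one_mul, Finsupp.prod_fintype _ _ fun i => pow_zero _]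
      rfl
    rw [this]
    exact (MvPolynomial.basisMonomials ι ℕ).constr_basis ℕ _ _
  have key : ∑ f : α → ι, ∏ i, (MvPolynomial.X i : MvPolynomial ι ℕ) ^ #{a | f a = i} =
      ∑ k ∈ piAntidiag univ (Fintype.card α), Nat.multinomial univ k •
        ∏ i, MvPolynomial.X i ^ k i := by
    have h1 := Finset.prod_univ_sum (fun _ : α => (univ : Finset ι))
      (fun _ i => (MvPolynomial.X i : MvPolynomial ι ℕ))
    rw [Fintype.piFinset_univ, prod_const, card_univ, sum_pow_eq_sum_piAntidiag] at h1
    simp only [nsmul_eq_mul, h1]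
    refine sum_congr rfl fun f _ => ?_
    rw [← Finset.prod_fiberwise' univ f (fun i => (MvPolynomial.X i : MvPolynomial ι ℕ))]
    exact prod_congr rfl fun i _ => (prod_const _).symm
  have := congrArg L key
  simpa only [map_sum, map_nsmul, hL] using this

/-- Surjections with a given kernel amount to bijections from the quotient. -/
noncomputable def surjectiveKerEquiv {α β : Type*} (s : Setoid α) :
    {f : α → β // Function.Surjective f ∧ Setoid.ker f = s} ≃ (Quotient s ≃ β) where
  toFun f := Equiv.ofBijective
    (Quotient.lift f.1 fun a b (hab : s a b) => by rw [← f.2.2] at hab; exact hab)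
    ⟨by
      rintro ⟨a⟩ ⟨b⟩ hab
      refine Quotient.sound ?_
      change s a b
      rw [← f.2.2]
      exact hab, fun b => (f.2.1 b).imp' (Quotient.mk s) fun _ h => h⟩
  invFun e := ⟨fun a => e (Quotient.mk s a), e.surjective.comp Quotient.mk_surjective,
    Setoid.ext fun a b => e.injective.eq_iff.trans Quotient.eq⟩
  left_inv _ := rfl
  right_inv _ := Equiv.ext <| by rintro ⟨a⟩; rfl

open Classical in
/-- Each set partition with `m` blocks is the kernel of `m!` surjections onto `m` points. -/
theorem sum_surjective_ker {α R : Type*} [Fintype α] [Fintype (Setoid α)] [AddCommMonoid R]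
    (m : ℕ) (G : Setoid α → R) :
    ∑ f : α → Fin m with Function.Surjective f, G (Setoid.ker f) =
      m ! • ∑ s : Setoid α with Nat.card (Quotient s) = m, G s := by
  rw [← sum_fiberwise _ (fun f => Setoid.ker f), smul_sum, sum_filter _ (fun s => m ! • G s)]
  refine sum_congr rfl fun s _ => ?_
  rw [filter_filter, sum_congr rfl (g := fun _ => G s)
    (fun f hf => by rw [(mem_filter.1 hf).2.2]), sum_const, ← Fintype.card_subtype,
    Fintype.card_congr (surjectiveKerEquiv s)]
  split_ifs with hs
  · rw [Fintype.card_equiv (Finite.equivFinOfCardEq hs), ← Nat.card_eq_fintype_card, hs]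
  · rw [Fintype.card_eq_zero_iff.2, zero_smul]
    exact ⟨fun e => hs (by rw [Nat.card_congr e, Nat.card_fin])⟩

variable (K : Type*) [Field K] {A : Type*} [CommRing A] [Algebra K A]

theorem multinomial_cast_eq [CharZero K] {ι : Type*} [Fintype ι] (k : ι → ℕ) {n : ℕ}
    (hk : ∑ i, k i = n) :
    (Nat.multinomial univ k : K) = n ! * ∏ i, ((k i)! : K)⁻¹ := by
  rw [← hk, ← Nat.multinomial_spec univ k, Finset.prod_inv_distrib]
  push_cast
  rw [mul_comm, ← mul_assoc, inv_mul_cancel₀, one_mul]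
  exact prod_ne_zero_iff.2 fun i _ => Nat.cast_ne_zero.2 (Nat.factorial_ne_zero _)

/-- Compositions into `m` positive parts, recorded by their parts or by the multiplicities of
the parts. -/
theorem sum_positive_eq_sum_multiplicity [CharZero K] {n m : ℕ} (hmn : m ≤ n) (z : ℕ → A) :
    ∑ b ∈ piAntidiag (univ : Finset (Fin m)) n with ∀ i, b i ≠ 0, ∏ i, z (b i) =
      ∑ k ∈ piAntidiag (univ : Finset (Fin (n - m + 1))) m with ∑ j, (j.1 + 1) * k j = n,
        ((m ! : K) / ∏ j, ((k j)! : K)) • ∏ j, z (j.1 + 1) ^ k j := by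
  have h1 : ∑ b ∈ piAntidiag (univ : Finset (Fin m)) n with ∀ i, b i ≠ 0, ∏ i, z (b i) =
      ∑ g : Fin m → Fin (n - m + 1) with ∑ i, ((g i).1 + 1) = n, ∏ i, z ((g i).1 + 1) := by
    symm
    refine sum_bij (fun g _ i => (g i).1 + 1) ?_ ?_ ?_ fun _ _ => rfl
    · intro g hg
      simpa using hg
    · intro g _ g' _ h
      exact funext fun i => Fin.ext (by simpa using congrFun h i)
    · intro b hb
      simp only [mem_filter, mem_piAntidiag, mem_univ, implies_true, and_true] at hb
      -- The other m - 1 parts are at least 1, so no part exceeds n - m + 1.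
      have hle (i : Fin m) : b i - 1 < n - m + 1 := by
        have h2 : ∑ j ∈ univ.erase i, 1 ≤ ∑ j ∈ univ.erase i, b j :=
          sum_le_sum fun j _ => Nat.one_le_iff_ne_zero.2 (hb.2 j)
        have h3 := add_sum_erase univ b (mem_univ i)
        simp only [sum_const, card_erase_of_mem (mem_univ i), card_univ, Fintype.card_fin,
          smul_eq_mul, mul_one] at h2
        have h4 : ∑ j, b j = n := hb.1
        have := hb.2 i
        have := i.2
        omega
      have hb1 (i : Fin m) : b i - 1 + 1 = b i := Nat.succ_pred (hb.2 i)
      refine ⟨fun i => ⟨b i - 1, hle i⟩, ?_, funext hb1⟩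
      simp only [mem_filter, mem_univ, true_and, hb1, hb.1]
  -- Both the constraint and the product depend only on how often each part occurs, so
  -- `sum_fiber_card` applies.
  obtain ⟨Φ, hΦ⟩ : ∃ Φ : (Fin (n - m + 1) → ℕ) → A, ∀ k, Φ k =
      if ∑ j, (j.1 + 1) * k j = n then ∏ j, z (j.1 + 1) ^ k j else 0 := ⟨_, fun _ => rfl⟩
  have h2 (g : Fin m → Fin (n - m + 1)) :
      (if ∑ i, ((g i).1 + 1) = n then ∏ i, z ((g i).1 + 1) else 0) =
        Φ fun j => #{i | g i = j} := by
    rw [hΦ]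
    have hs := Finset.sum_fiberwise' univ g (fun j => j.1 + 1)
    have hp := Finset.prod_fiberwise' univ g (fun j => z (j.1 + 1))
    simp only [sum_const, prod_const, smul_eq_mul] at hs hp
    simp only [← hs, ← hp, mul_comm]
  rw [h1, sum_filter, sum_congr rfl fun g _ => h2 g, sum_fiber_card Φ, sum_filter, Fintype.card_fin]
  refine sum_congr rfl fun k hk => ?_
  rw [mem_piAntidiag] at hk
  rw [hΦ]
  split_ifs
  · rw [← Nat.cast_smul_eq_nsmul K, multinomial_cast_eq K k hk.1, div_eq_mul_inv,
      Finset.prod_inv_distrib]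
  · exact smul_zero _

/-- The Bell polynomial enumerates the set partitions of an `n`-element set with `m` blocks by
the sizes of the blocks. -/
theorem sum_setoid_eq_bellPoly [CharZero K] {α : Type*} [Fintype α] [Fintype (Setoid α)]
    [∀ s : Setoid α, Fintype (Quotient s)] {m : ℕ} (hm : m ≤ Fintype.card α) (y : ℕ → A) :
    ∑ s : Setoid α with Nat.card (Quotient s) = m,
        ∏ W : Quotient s, y (Nat.card {a // Quotient.mk s a = W}) =
      bellPoly K (Fintype.card α) m y := by
  classical
  set n := Fintype.card α with hn
  have hfac : (m ! : K) ≠ 0 := Nat.cast_ne_zero.2 (Nat.factorial_ne_zero _)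
  -- After multiplying by m!, partitions into m blocks become surjections onto `Fin m`, whose fibres
  -- are the blocks.
  refine (smul_right_injective A hfac) ?_
  change (m ! : K) • _ = (m ! : K) • _
  have h1 (f : α → Fin m) (hf : Function.Surjective f) :
      ∏ W : Quotient (Setoid.ker f), y (Nat.card {a // Quotient.mk (Setoid.ker f) a = W}) =
        ∏ i, y #{a | f a = i} := by
    refine Fintype.prod_equiv (Setoid.quotientKerEquivOfSurjective f hf) _ _ ?_
    rintro ⟨b⟩
    rw [← Fintype.card_subtype, Nat.card_eq_fintype_card.symm]
    exact congrArg y (Nat.card_congr (Equiv.subtypeEquivRight fun a => Quotient.eq))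
  obtain ⟨Φ, hΦ⟩ : ∃ Φ : (Fin m → ℕ) → A, ∀ b, Φ b =
      if ∀ i, b i ≠ 0 then ∏ i, y (b i) else 0 := ⟨_, fun _ => rfl⟩
  have h2 (f : α → Fin m) :
      (if Function.Surjective f then ∏ i, y #{a | f a = i} else 0) =
        Φ fun i => #{a | f a = i} := by
    rw [hΦ]
    refine if_congr (forall_congr' fun i => ?_) rfl rfl
    rw [← Nat.pos_iff_ne_zero, card_pos]
    simp [Finset.Nonempty]
  rw [Nat.cast_smul_eq_nsmul K, ← sum_surjective_ker m
      (fun s => ∏ W : Quotient s, y (Nat.card {a // Quotient.mk s a = W})),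
    sum_congr rfl fun f hf => h1 f (mem_filter.1 hf).2, sum_filter,
    sum_congr rfl fun f _ => h2 f, sum_fiber_card Φ, ← hn]
  -- The denominators of the multinomial coefficient are absorbed into the arguments as y_b / b!.
  have h3 (b : Fin m → ℕ) (hb : b ∈ piAntidiag univ n) :
      Nat.multinomial univ b • Φ b =
        (n ! : K) • if ∀ i, b i ≠ 0 then ∏ i, ((b i)! : K)⁻¹ • y (b i) else 0 := by
    rw [hΦ]
    split_ifs
    · rw [← Nat.cast_smul_eq_nsmul K, multinomial_cast_eq K b (mem_piAntidiag.1 hb).1, mul_smul,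
        Finset.prod_smul]
    · rw [smul_zero, smul_zero]
  rw [sum_congr rfl h3, ← smul_sum, ← sum_filter,
    sum_positive_eq_sum_multiplicity K hm (fun j => (j ! : K)⁻¹ • y j), bellPoly,
    smul_sum, smul_sum]
  refine sum_congr ?_ fun k _ => ?_
  -- The bound k_j ≤ n in `bellPoly` is automatic, since k_j ≤ m ≤ n.
  · ext k
    simp only [mem_filter, mem_piAntidiag, mem_univ, implies_true, and_true, Fintype.mem_piFinset,
      mem_range]
    refine ⟨fun h => ⟨fun j => ?_, h⟩, fun h => h.2⟩
    have h4 : ∑ j, k j = m := h.1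
    have := single_le_sum (f := k) (fun i _ => Nat.zero_le _) (mem_univ j)
    omega
  · rw [smul_smul, smul_smul]
    congr 1
    ring

end Bell

/-! ### Unique factorization of products of partition lattices -/

section Coatoms

/-- The coatoms of a poset. -/
abbrev Coatom (α : Type*) [PartialOrder α] [OrderTop α] := {c : α // IsCoatom c}

/-- Two coatoms are related if they are equal or if a third coatom lies above all their common
lower bounds. -/
def Coatom.Rel {α : Type*} [PartialOrder α] [OrderTop α] (c d : Coatom α) : Prop :=
  c = d ∨ ∃ e : Coatom α, e ≠ c ∧ e ≠ d ∧ ∀ z : α, z ≤ c.1 → z ≤ d.1 → z ≤ e.1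

/-- The number of coatoms that are related to exactly `m` coatoms. -/
noncomputable def coatomCount (α : Type*) [PartialOrder α] [OrderTop α] (m : ℕ) : ℕ :=
  Nat.card {c : Coatom α // Nat.card {d : Coatom α // c.Rel d} = m}

/-- An isomorphism of posets restricts to coatoms. -/
def coatomCongr {α β : Type*} [PartialOrder α] [OrderTop α] [PartialOrder β] [OrderTop β]
    (e : α ≃o β) : Coatom α ≃ Coatom β :=
  e.toEquiv.subtypeEquiv fun c => (e.isCoatom_iff c).symm

theorem coatomCongr_rel {α β : Type*} [PartialOrder α] [OrderTop α] [PartialOrder β] [OrderTop β]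
    (e : α ≃o β) (c d : Coatom α) : (coatomCongr e c).Rel (coatomCongr e d) ↔ c.Rel d := by
  refine or_congr (coatomCongr e).injective.eq_iff ?_
  rw [← (coatomCongr e).exists_congr_right]
  refine exists_congr fun x => and_congr (coatomCongr e).injective.ne_iff
    (and_congr (coatomCongr e).injective.ne_iff ?_)
  rw [← e.toEquiv.forall_congr_right]
  exact forall_congr' fun z => imp_congr e.le_iff_le (imp_congr e.le_iff_le e.le_iff_le)

theorem coatomCount_congr {α β : Type*} [PartialOrder α] [OrderTop α] [PartialOrder β]
    [OrderTop β] (e : α ≃o β) (m : ℕ) : coatomCount α m = coatomCount β m := by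
  refine Nat.card_congr ((coatomCongr e).subtypeEquiv fun c => ?_)
  rw [Nat.card_congr ((coatomCongr e).subtypeEquiv fun d => (coatomCongr_rel e c d).symm)]

variable {ι : Type*} [DecidableEq ι] {π : ι → Type*} [∀ i, PartialOrder (π i)]
  [∀ i, OrderTop (π i)]

theorem isCoatom_update_top {i : ι} {a : π i} (ha : IsCoatom a) :
    IsCoatom (Function.update (⊤ : ∀ i, π i) i a) := by
  refine ⟨fun h => ha.1 ?_, fun b hb => funext fun j => ?_⟩
  · simpa using congrFun h i
  · have hj (j) (hji : j ≠ i) : b j = ⊤ :=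
      top_le_iff.1 (by simpa [Function.update_of_ne hji] using hb.le j)
    by_cases hji : j = i
    · subst hji
      refine ha.2 _ (lt_of_le_of_ne (by simpa using hb.le j) fun h => hb.ne ?_)
      exact Function.update_eq_iff.2 ⟨h, fun k hk => (hj k hk).symm⟩
    · exact hj j hji

/-- Resetting to `⊤` all coordinates but one that is not `⊤` gives an element above `f` and still
below `⊤`, hence `f` itself. -/
theorem exists_eq_update_top {f : ∀ i, π i} (hf : IsCoatom f) :
    ∃ i, ∃ a : π i, IsCoatom a ∧ f = Function.update ⊤ i a := by
  obtain ⟨i, hi⟩ := Function.ne_iff.1 hf.1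
  have h : f = Function.update ⊤ i (f i) := by
    refine ((hf.le_iff_eq fun h => hi ?_).1 ?_).symm
    · simpa using congrFun h i
    · exact le_update_iff.2 ⟨le_rfl, fun _ _ => le_top⟩
  refine ⟨i, f i, ⟨hi, fun b hb => ?_⟩, h⟩
  have := hf.2 (Function.update ⊤ i b) (by rw [h]; exact update_lt_update_iff.2 hb)
  simpa using congrFun this i

/-- The coatoms of a product are the coatoms of its factors. -/
noncomputable def coatomPiEquiv : (Σ i, Coatom (π i)) ≃ Coatom (∀ i, π i) :=
  Equiv.ofBijective (fun p => ⟨Function.update ⊤ p.1 p.2.1, isCoatom_update_top p.2.2⟩) <| by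
    constructor
    · rintro ⟨i, a, ha⟩ ⟨j, b, hb⟩ h
      replace h : Function.update ⊤ i a = Function.update ⊤ j b := congrArg Subtype.val h
      by_cases hij : i = j
      · subst hij
        obtain rfl := Function.update_injective _ _ h
        rfl
      · refine absurd ?_ ha.1
        simpa [Function.update_of_ne hij] using congrFun h i
    · rintro ⟨f, hf⟩
      obtain ⟨i, a, ha, rfl⟩ := exists_eq_update_top hf
      exact ⟨⟨i, a, ha⟩, rfl⟩

/-- For coatoms `a`, `b` of different factors, the element with these two coordinates and `⊤`
elsewhere lies below both, and no third coatom lies above it. Within one factor the relation is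
inherited from that factor. -/
theorem coatomPiEquiv_rel (hπ : ∀ i (c d : Coatom (π i)), c.Rel d) (p q : Σ i, Coatom (π i)) :
    (coatomPiEquiv p).Rel (coatomPiEquiv q) ↔ q.1 = p.1 := by
  constructor
  · rintro (h | ⟨e, hep, heq, hz⟩)
    · rw [coatomPiEquiv.injective h]
    · obtain ⟨r, rfl⟩ := coatomPiEquiv.surjective e
      obtain ⟨i, a⟩ := p
      obtain ⟨j, b⟩ := q
      obtain ⟨k, c⟩ := r
      by_contra hij
      replace hij : j ≠ i := hij
      have h := hz (Function.update (Function.update ⊤ i a.1) j b.1)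
        (update_le_iff.2 ⟨le_top.trans (Function.update_of_ne hij a.1 ⊤).ge,
          fun _ _ => le_rfl⟩)
        (update_le_update_iff.2 ⟨le_rfl, fun _ _ => le_top⟩) k
      replace h : _ ≤ c.1 := h.trans_eq (Function.update_self k c.1 _)
      by_cases hkj : k = j
      · subst hkj
        rw [Function.update_self] at h
        exact heq (by rw [Subtype.ext ((b.2.le_iff_eq c.2.1).1 h)])
      rw [Function.update_of_ne hkj] at h
      by_cases hki : k = i
      · subst hki
        rw [Function.update_self] at h
        exact hep (by rw [Subtype.ext ((a.2.le_iff_eq c.2.1).1 h)])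
      rw [Function.update_of_ne hki] at h
      exact c.2.1 (top_le_iff.1 h)
  · obtain ⟨i, a⟩ := p
    obtain ⟨j, b⟩ := q
    rintro (rfl : j = i)
    rcases hπ j a b with h | ⟨e, hea, heb, hz⟩
    · exact Or.inl (by rw [h])
    · refine Or.inr ⟨coatomPiEquiv ⟨j, e⟩, ?_, ?_, fun z hza hzb => ?_⟩
      · simpa using hea
      · simpa using heb
      · refine le_update_iff.2 ⟨hz _ ?_ ?_, fun _ _ => le_top⟩
        · exact (le_update_iff.1 hza).1
        · exact (le_update_iff.1 hzb).1

/-- A coatom is related exactly to the coatoms of its own factor, so each factor with `m` coatoms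
contributes all `m` of them. -/
theorem coatomCount_pi [Finite ι] (hπ : ∀ i (c d : Coatom (π i)), c.Rel d) {m : ℕ} (hm : m ≠ 0) :
    coatomCount (∀ i, π i) m = m * Nat.card {i // Nat.card (Coatom (π i)) = m} := by
  have : Fintype ι := Fintype.ofFinite ι
  have hdeg (p : Σ i, Coatom (π i)) :
      Nat.card {d // (coatomPiEquiv p).Rel d} = Nat.card (Coatom (π p.1)) := by
    rw [← Nat.card_congr (coatomPiEquiv.subtypeEquiv fun q => (coatomPiEquiv_rel hπ p q).symm)]
    exact Nat.card_congr (Equiv.sigmaSubtype p.1)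
  rw [coatomCount, ← Nat.card_congr (coatomPiEquiv.subtypeEquiv fun p =>
      show Nat.card (Coatom (π p.1)) = m ↔ _ by rw [← hdeg p]),
    Nat.card_congr (Equiv.subtypeSigmaEquiv (fun i => Coatom (π i))
      fun i => Nat.card (Coatom (π i)) = m)]
  -- `Nat.card` is 0 on infinite types, which `hm` excludes.
  have hfin (i : {i // Nat.card (Coatom (π i)) = m}) : Finite (Coatom (π i.1)) :=
    Nat.finite_of_card_ne_zero (i.2.trans_ne hm)
  rw [Nat.card_sigma, Fintype.sum_congr _ _ fun i => i.2, Finset.sum_const, smul_eq_mul,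
    mul_comm, Finset.card_univ, Nat.card_eq_fintype_card]

end Coatoms

/-! ### Coatoms of the lattice of equivalence relations. -/

section SetoidCoatoms

variable {α : Type*}

/-- Coatoms are the partitions into two blocks, encoded by a predicate; conversely, a coatom
separates the class of some `x` from the rest. -/
theorem setoid_isCoatom_iff {r : Setoid α} :
    IsCoatom r ↔ r ≠ ⊤ ∧ ∃ p : α → Prop, Setoid.ker p = r := by
  constructor
  · intro hr
    refine ⟨hr.1, ?_⟩
    obtain ⟨x, y, hxy⟩ : ∃ x y, ¬ r x y := by
      simpa [Setoid.eq_top_iff] using hr.1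
    refine ⟨fun a => r a x, (hr.le_iff_eq fun h => hxy ?_).1 fun a b hab => ?_⟩
    · exact r.symm ((Setoid.eq_top_iff.1 h y x).mpr (r.refl x))
    · exact propext ⟨fun h => r.trans (r.symm hab) h, fun h => r.trans hab h⟩
  · rintro ⟨hr, p, rfl⟩
    refine ⟨hr, fun s hs => ?_⟩
    obtain ⟨x, y, hxy, hp⟩ : ∃ x y, s x y ∧ p x ≠ p y := by
      by_contra! h
      exact hs.not_ge fun a b hab => h a b hab
    have hx (z : α) : s z x := by
      by_cases h : p z = p x
      · exact hs.le h
      · refine s.trans (hs.le (?_ : p z = p y)) (s.symm hxy)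
        by_cases p x <;> by_cases p y <;> by_cases p z <;> simp_all
    exact Setoid.eq_top_iff.2 fun a b => s.trans (hx a) (s.symm (hx b))

theorem setoid_coatom_rel (c d : Coatom (Setoid α)) : c.Rel d := by
  refine or_iff_not_imp_left.2 fun hcd => ?_
  obtain ⟨r, hr⟩ := c
  obtain ⟨s, hs⟩ := d
  obtain ⟨hr', p, rfl⟩ := setoid_isCoatom_iff.1 hr
  obtain ⟨hs', q, rfl⟩ := setoid_isCoatom_iff.1 hs
  -- The third bipartition is the "exclusive or" of the other two: any two of `p`, `q`, `p ↔ q`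
  -- determine the third up to complement.
  let t : Setoid α := Setoid.ker fun x => (p x ↔ q x)
  have hp (x y) : Setoid.ker p x y ↔ (p x ↔ p y) := eq_iff_iff
  have hq (x y) : Setoid.ker q x y ↔ (q x ↔ q y) := eq_iff_iff
  have ht (x y) : t x y ↔ ((p x ↔ q x) ↔ (p y ↔ q y)) := eq_iff_iff
  have ht' : IsCoatom t := by
    refine setoid_isCoatom_iff.2 ⟨fun h => hcd (Subtype.ext (Setoid.ext fun x y => ?_)), _, rfl⟩
    have h1 := (ht x y).1 (Setoid.eq_top_iff.1 h x y)
    rw [hp, hq]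
    tauto
  refine ⟨⟨t, ht'⟩, fun h => hs' (Setoid.eq_top_iff.2 fun x y => ?_),
    fun h => hr' (Setoid.eq_top_iff.2 fun x y => ?_), fun z hz hz' x y hxy => ?_⟩
  · have h1 := (ht x y).symm.trans
      ((show t = Setoid.ker p from congrArg Subtype.val h) ▸ hp x y)
    rw [hq]
    tauto
  · have h1 := (ht x y).symm.trans
      ((show t = Setoid.ker q from congrArg Subtype.val h) ▸ hq x y)
    rw [hp]
    tauto
  · have h1 := (hp x y).1 (hz hxy)
    have h2 := (hq x y).1 (hz' hxy)
    rw [ht]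
    tauto

/-- A bipartition is determined by its block avoiding a fixed point `a₀`, an arbitrary nonempty
subset of the complement of `a₀`. -/
theorem card_setoid_coatom [Finite α] [Nonempty α] :
    Nat.card (Coatom (Setoid α)) = 2 ^ (Nat.card α - 1) - 1 := by
  classical
  have : Fintype α := Fintype.ofFinite α
  let a₀ : α := Classical.arbitrary α
  let φ (S : {S : Set {a // a ≠ a₀} // S ≠ ∅}) : Coatom (Setoid α) :=
    ⟨Setoid.ker fun a => a ∈ Subtype.val '' S.1, setoid_isCoatom_iff.2 ⟨fun h => by
      obtain ⟨s, hs⟩ := Set.nonempty_iff_ne_empty.2 S.2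
      have : (s.1 ∈ Subtype.val '' S.1) = (a₀ ∈ Subtype.val '' S.1) :=
        Setoid.eq_top_iff.1 h s.1 a₀
      obtain ⟨b, -, hb⟩ := this.mp ⟨s, hs, rfl⟩
      exact b.2 hb, _, rfl⟩⟩
  have hφ (S a) (ha : a ≠ a₀) : (φ S).1 a a₀ ↔ (⟨a, ha⟩ : {a // a ≠ a₀}) ∉ S.1 := by
    have h1 : (φ S).1 a a₀ ↔ ((a ∈ Subtype.val '' S.1) ↔ (a₀ ∈ Subtype.val '' S.1)) := eq_iff_iff
    rw [h1]
    simp [ha]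
  have hbij : Function.Bijective φ := by
    constructor
    · intro S T h
      refine Subtype.ext (Set.ext fun a => ?_)
      rw [← not_iff_not, ← hφ S a.1 a.2, ← hφ T a.1 a.2, h]
    · rintro ⟨r, hr⟩
      obtain ⟨hr', p, rfl⟩ := setoid_isCoatom_iff.1 hr
      refine ⟨⟨{a | p a.1 ≠ p a₀}, fun h => hr' (Setoid.eq_top_iff.2 ?_)⟩, Subtype.ext
        (Setoid.ext fun x y => ?_)⟩
      · have h1 (x) : p x = p a₀ := by
          by_cases hx : x = a₀
          · rw [hx]
          · by_contra hpx
            exact Set.eq_empty_iff_forall_notMem.1 h ⟨x, hx⟩ hpx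
        exact fun x y => (h1 x).trans (h1 y).symm
      · have h1 (x) : x ∈ Subtype.val '' {a : {a // a ≠ a₀} | p a.1 ≠ p a₀} ↔ p x ≠ p a₀ :=
          ⟨by rintro ⟨a, ha, rfl⟩; exact ha, fun hx => ⟨⟨x, fun h => hx (h ▸ rfl)⟩, hx, rfl⟩⟩
        change (_ = _) ↔ (_ = _)
        simp only [h1]
        by_cases p x <;> by_cases p y <;> by_cases p a₀ <;> simp_all
  rw [← Nat.card_congr (Equiv.ofBijective φ hbij), Nat.card_eq_fintype_card,
    Nat.card_eq_fintype_card, Fintype.card_subtype_compl, Fintype.card_set,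
    Fintype.card_subtype_compl]
  simp

/-- The sizes greater than one of the sets `A i` are determined by the product of the lattices of
equivalence relations on them. -/
theorem card_eq_card_of_orderIso {ι κ : Type*} [Finite ι] [Finite κ] {A : ι → Type*}
    {B : κ → Type*} [∀ i, Finite (A i)] [∀ i, Nonempty (A i)] [∀ j, Finite (B j)]
    [∀ j, Nonempty (B j)] (e : (∀ i, Setoid (A i)) ≃o ∀ j, Setoid (B j)) {k : ℕ} (hk : 1 < k) :
    Nat.card {i // Nat.card (A i) = k} = Nat.card {j // Nat.card (B j) = k} := by
  classical
  have hm : 0 < 2 ^ (k - 1) - 1 := by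
    have := Nat.one_lt_two_pow (n := k - 1) (by omega)
    omega
  have hcard (n : ℕ) (hn : 0 < n) : 2 ^ (n - 1) - 1 = 2 ^ (k - 1) - 1 ↔ n = k := by
    refine ⟨fun h => ?_, fun h => by rw [h]⟩
    have h1 := Nat.one_le_two_pow (n := n - 1)
    have h2 := Nat.one_le_two_pow (n := k - 1)
    have := Nat.pow_right_injective le_rfl (show 2 ^ (n - 1) = 2 ^ (k - 1) by omega)
    omega
  have h := coatomCount_congr e (2 ^ (k - 1) - 1)
  rw [coatomCount_pi (fun _ => setoid_coatom_rel) hm.ne',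
    coatomCount_pi (fun _ => setoid_coatom_rel) hm.ne'] at h
  have h' := Nat.eq_of_mul_eq_mul_left hm h
  simp only [card_setoid_coatom, hcard _ Nat.card_pos] at h'
  exact h'

/-- Sizes greater than one agree with multiplicity, and singletons contribute `G 1 = 1`. A
multiplicative invariant is therefore independent of the decomposition. -/
theorem finprod_card_eq_of_orderIso {M ι κ : Type*} [CommMonoid M] [Finite ι] [Finite κ]
    {A : ι → Type*} {B : κ → Type*} [∀ i, Finite (A i)] [∀ i, Nonempty (A i)]
    [∀ j, Finite (B j)] [∀ j, Nonempty (B j)] (e : (∀ i, Setoid (A i)) ≃o ∀ j, Setoid (B j))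
    (G : ℕ → M) (hG : G 1 = 1) : ∏ᶠ i, G (Nat.card (A i)) = ∏ᶠ j, G (Nat.card (B j)) := by
  classical
  have : Fintype ι := Fintype.ofFinite ι
  have : Fintype κ := Fintype.ofFinite κ
  rw [finprod_eq_prod_of_fintype, finprod_eq_prod_of_fintype]
  let T : Finset ℕ := Finset.univ.image (fun i => Nat.card (A i)) ∪
    Finset.univ.image (fun j => Nat.card (B j))
  rw [← Finset.prod_fiberwise_of_maps_to' (t := T) (g := fun i => Nat.card (A i))
      (fun i _ => Finset.mem_union_left _ (Finset.mem_image_of_mem _ (Finset.mem_univ i))) G,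
    ← Finset.prod_fiberwise_of_maps_to' (t := T) (g := fun j => Nat.card (B j))
      (fun j _ => Finset.mem_union_right _ (Finset.mem_image_of_mem _ (Finset.mem_univ j))) G]
  refine Finset.prod_congr rfl fun k _ => ?_
  rw [Finset.prod_const, Finset.prod_const]
  rcases Nat.lt_trichotomy k 1 with hk | rfl | hk
  · obtain rfl : k = 0 := by omega
    simp [Nat.card_pos.ne']
  · rw [hG, one_pow, one_pow]
  · rw [← Fintype.card_subtype, ← Fintype.card_subtype, ← Nat.card_eq_fintype_card,
      ← Nat.card_eq_fintype_card, card_eq_card_of_orderIso e hk]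

end SetoidCoatoms

/-! ### Transport of Hopf algebra structures -/

theorem IsHopf.of_algEquiv {K A B : Type*} [CommRing K] [Ring A] [Algebra K A] [Ring B]
    [Algebra K B] {Δ : A →ₗ[K] A ⊗[K] A} {ε : A →ₗ[K] K} (hA : IsHopf Δ ε)
    {Δ' : B →ₐ[K] B ⊗[K] B} {ε' : B →ₐ[K] K} (e : A ≃ₐ[K] B)
    (hΔ : ∀ a, Δ' (e a) = TensorProduct.map e.toLinearMap e.toLinearMap (Δ a))
    (hε : ∀ a, ε' (e a) = ε a) : IsHopf Δ'.toLinearMap ε'.toLinearMap where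
  coassoc := by
    have h1 : Δ'.toLinearMap.rTensor B ∘ₗ TensorProduct.map e.toLinearMap e.toLinearMap =
        TensorProduct.map (TensorProduct.map e.toLinearMap e.toLinearMap) e.toLinearMap ∘ₗ
          Δ.rTensor A :=
      TensorProduct.ext' fun a b => by simp [hΔ]
    have h2 : Δ'.toLinearMap.lTensor B ∘ₗ TensorProduct.map e.toLinearMap e.toLinearMap =
        TensorProduct.map e.toLinearMap (TensorProduct.map e.toLinearMap e.toLinearMap) ∘ₗ
          Δ.lTensor A :=
      TensorProduct.ext' fun a b => by simp [hΔ]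
    have h3 : (TensorProduct.assoc K B B B).toLinearMap ∘ₗ
        TensorProduct.map (TensorProduct.map e.toLinearMap e.toLinearMap) e.toLinearMap =
        TensorProduct.map e.toLinearMap (TensorProduct.map e.toLinearMap e.toLinearMap) ∘ₗ
          (TensorProduct.assoc K A A A).toLinearMap :=
      TensorProduct.ext_threefold fun a b c => rfl
    refine LinearMap.ext fun b => ?_
    obtain ⟨a, rfl⟩ := e.surjective b
    have h4 := LinearMap.congr_fun h1 (Δ a)
    have h5 := LinearMap.congr_fun h2 (Δ a)
    have h6 := LinearMap.congr_fun h3 (Δ.rTensor A (Δ a))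
    have h7 := LinearMap.congr_fun hA.coassoc a
    simp only [LinearMap.comp_apply, AlgHom.toLinearMap_apply, hΔ] at h4 h5 h6 h7 ⊢
    rw [h4, h5, h6, h7]
  rTensor_counit := by
    have h1 : ε'.toLinearMap.rTensor B ∘ₗ TensorProduct.map e.toLinearMap e.toLinearMap =
        e.toLinearMap.lTensor K ∘ₗ ε.rTensor A :=
      TensorProduct.ext' fun a b => by simp [hε]
    refine LinearMap.ext fun b => ?_
    obtain ⟨a, rfl⟩ := e.surjective b
    have h4 := LinearMap.congr_fun h1 (Δ a)
    have h7 := LinearMap.congr_fun hA.rTensor_counit a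
    simp only [LinearMap.comp_apply, AlgHom.toLinearMap_apply, hΔ] at h4 h7 ⊢
    rw [h4, h7]
    rfl
  lTensor_counit := by
    have h1 : ε'.toLinearMap.lTensor B ∘ₗ TensorProduct.map e.toLinearMap e.toLinearMap =
        e.toLinearMap.rTensor K ∘ₗ ε.lTensor A :=
      TensorProduct.ext' fun a b => by simp [hε]
    refine LinearMap.ext fun b => ?_
    obtain ⟨a, rfl⟩ := e.surjective b
    have h4 := LinearMap.congr_fun h1 (Δ a)
    have h7 := LinearMap.congr_fun hA.lTensor_counit a
    simp only [LinearMap.comp_apply, AlgHom.toLinearMap_apply, hΔ] at h4 h7 ⊢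
    rw [h4, h7]
    rfl
  counit_one := map_one ε'
  counit_mul := map_mul ε'
  comul_one := map_one Δ'
  comul_mul := map_mul Δ'
  exists_antipode := by
    obtain ⟨S, hl, hr⟩ := hA.exists_antipode
    -- The antipode is conjugated by `e`.
    let S' : B →ₗ[K] B := e.toLinearMap ∘ₗ S ∘ₗ e.symm.toLinearMap
    have h1 : LinearMap.mul' K B ∘ₗ S'.rTensor B ∘ₗ TensorProduct.map e.toLinearMap e.toLinearMap =
        e.toLinearMap ∘ₗ LinearMap.mul' K A ∘ₗ S.rTensor A :=
      TensorProduct.ext' fun a b => by simp [S']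
    have h2 : LinearMap.mul' K B ∘ₗ S'.lTensor B ∘ₗ TensorProduct.map e.toLinearMap e.toLinearMap =
        e.toLinearMap ∘ₗ LinearMap.mul' K A ∘ₗ S.lTensor A :=
      TensorProduct.ext' fun a b => by simp [S']
    refine ⟨S', LinearMap.ext fun b => ?_, LinearMap.ext fun b => ?_⟩
    · obtain ⟨a, rfl⟩ := e.surjective b
      have h4 := LinearMap.congr_fun h1 (Δ a)
      have h7 := LinearMap.congr_fun hl a
      simp only [LinearMap.comp_apply, AlgHom.toLinearMap_apply, hΔ, hε] at h4 h7 ⊢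
      rw [h4, h7]
      exact e.commutes _
    · obtain ⟨a, rfl⟩ := e.surjective b
      have h4 := LinearMap.congr_fun h2 (Δ a)
      have h7 := LinearMap.congr_fun hr a
      simp only [LinearMap.comp_apply, AlgHom.toLinearMap_apply, hΔ, hε] at h4 h7 ⊢
      rw [h4, h7]
      exact e.commutes _

/-! ### The isomorphism -/

section Iso

open scoped Nat

/-- A dependent product over a sum type is the product of two dependent products. -/
def sumPiOrderIso {ι κ : Type*} {α : ι ⊕ κ → Type*} [∀ i, Preorder (α i)] :
    (∀ i, α i) ≃o (∀ i, α (Sum.inl i)) × ∀ j, α (Sum.inr j) where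
  toEquiv := Equiv.sumPiEquivProdPi α
  map_rel_iff' := fun {a b} => ⟨fun h i => by
    cases i with
    | inl i => exact h.1 i
    | inr i => exact h.2 i, fun h => ⟨fun i => h _, fun i => h _⟩⟩

/-- A product over `Option ι` splits off the factor at `none`. -/
def optionPiOrderIso {ι : Type*} {α : Option ι → Type*} [∀ i, Preorder (α i)] :
    (∀ i, α i) ≃o α none × ∀ i, α (some i) where
  toEquiv := Equiv.piOptionEquivProd
  map_rel_iff' := fun {a b} => ⟨fun h i => by
    cases i with
    | none => exact h.1
    | some i => exact h.2 i, fun h => ⟨h _, fun i => h _⟩⟩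

/-- Reindexing a product of posets. -/
def piCongrLeftOrderIso {ι κ : Type*} (e : ι ≃ κ) {α : κ → Type*} [∀ i, Preorder (α i)] :
    (∀ i, α (e i)) ≃o ∀ j, α j where
  toEquiv := Equiv.piCongrLeft α e
  map_rel_iff' := fun {a b} => by
    change (∀ _, _) ↔ ∀ _, _
    rw [← e.forall_congr_right]
    simp only [Equiv.piCongrLeft_apply_apply]

variable (K : Type*) [Field K]

/-- The image of the class of the lattice of partitions of an `n`-element set. -/
noncomputable def FdB.gen (n : ℕ) : FdB K := (n ! : K) • FdB.x K (n - 1)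

/-- One-point factors must be invisible, as `finprod_card_eq_of_orderIso` requires; here the
convention x_0 = 1 enters. -/
theorem FdB.gen_one : FdB.gen K 1 = 1 := by
  simp [FdB.gen, FdB.x]

variable {K}

/-- The monomial of the Faà di Bruno algebra attached to a product of partition lattices. -/
noncomputable def FamilyQ.value (K : Type*) [Field K] {P : BddPoset} (hP : FamilyQ P) : FdB K :=
  ∏ᶠ i : hP.choose, FdB.gen K (Nat.card (hP.choose_spec.choose_spec.choose i))

/-- The lattice of partitions as the lattice of equivalence relations. -/
noncomputable def setoidOrderIsoSP (A : Type) [Finite A] : Setoid A ≃o SP A :=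
  Setoid.Partition.orderIso A

/-- `FamilyQ.value` is defined by a chosen decomposition; unique factorization frees it from the
choice. -/
theorem FamilyQ.value_eq {P : BddPoset} (hP : FamilyQ P) {ι : Type} [Finite ι] {A : ι → Type}
    [∀ i, Finite (A i)] [∀ i, Nonempty (A i)] (e : P ≃o ∀ i, SP (A i)) :
    hP.value K = ∏ᶠ i, FdB.gen K (Nat.card (A i)) := by
  have := hP.choose_spec.choose
  have hfin := hP.choose_spec.choose_spec.choose_spec.choose
  have := hP.choose_spec.choose_spec.choose_spec.choose_spec.choose
  obtain ⟨f⟩ := hP.choose_spec.choose_spec.choose_spec.choose_spec.choose_spec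
  exact finprod_card_eq_of_orderIso
    (((orderIsoPi fun i => setoidOrderIsoSP _).trans (f.symm.trans e)).trans
      (orderIsoPi fun i => setoidOrderIsoSP (A i)).symm) _ (FdB.gen_one K)

theorem FamilyQ.value_congr {P Q : BddPoset} (e : P ≃o Q) (hP : FamilyQ P) (hQ : FamilyQ Q) :
    hP.value K = hQ.value K := by
  obtain ⟨ι, _, A, _, _, ⟨f⟩⟩ := id hQ
  rw [hQ.value_eq f, hP.value_eq (e.trans f)]

theorem FamilyQ.value_point : FamilyQ.point.value K = 1 := by
  rw [FamilyQ.value_eq (ι := PEmpty) (A := fun _ => PUnit) _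
    { toFun := fun _ i => i.elim
      invFun := fun _ => PUnit.unit
      right_inv := fun _ => funext fun i => i.elim
      map_rel_iff' := ⟨fun _ => trivial, fun _ i => i.elim⟩ }]
  exact finprod_of_isEmpty _

theorem FamilyQ.value_prod {P Q : BddPoset} (hP : FamilyQ P) (hQ : FamilyQ Q) :
    (FamilyQ.prod P Q hP hQ).value K = hP.value K * hQ.value K := by
  obtain ⟨ι, _, A, _, _, ⟨e⟩⟩ := id hP
  obtain ⟨κ, _, B, _, _, ⟨f⟩⟩ := id hQ
  have : ∀ i, Finite (Sum.elim A B i) := by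
    rintro (i | i) <;> dsimp <;> infer_instance
  have : ∀ i, Nonempty (Sum.elim A B i) := by
    rintro (i | i) <;> dsimp <;> infer_instance
  have := Fintype.ofFinite ι
  have := Fintype.ofFinite κ
  rw [hP.value_eq e, hQ.value_eq f, FamilyQ.value_eq (A := Sum.elim A B) _
    ((orderIsoProd e f).trans
      (sumPiOrderIso (α := fun i => (SP (Sum.elim A B i) : Type))).symm),
    finprod_eq_prod_of_fintype, finprod_eq_prod_of_fintype, finprod_eq_prod_of_fintype,
    Fintype.prod_sum_type]
  rfl

theorem FamilyQ.value_SP (A : Type) [Finite A] [Nonempty A] :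
    (familyQ_SP A).value K = FdB.gen K (Nat.card A) := by
  rw [FamilyQ.value_eq (ι := PUnit) (A := fun _ => A) _ (OrderIso.funUnique PUnit (SP A)).symm,
    finprod_unique]

/-- The classes of partition lattices generate `HQ K`; this is what makes `FdB.toHQ` a left inverse
of `HQ.toFdB`. -/
theorem cls_eq_finprod {ι : Type} [Finite ι] (A : ι → Type) [∀ i, Finite (A i)]
    [∀ i, Nonempty (A i)] (P : BddPoset) (hP : FamilyQ P) (e : P ≃o ∀ i, SP (A i)) :
    IncidenceAlg.cls K familyQ_isHereditary P hP =
      ∏ᶠ i, IncidenceAlg.cls K familyQ_isHereditary (SP (A i)) (familyQ_SP (A i)) := by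
  induction ι using Finite.induction_empty_option generalizing P with
  | of_equiv f ih =>
    rw [ih (fun i => A (f i)) P hP
      (e.trans (piCongrLeftOrderIso f (α := fun i => (SP (A i) : Type))).symm)]
    exact finprod_comp_equiv f (f := fun i =>
      IncidenceAlg.cls K familyQ_isHereditary (SP (A i)) (familyQ_SP (A i)))
  | h_empty =>
    rw [finprod_of_isEmpty, ← IncidenceAlg.cls_point]
    exact IncidenceAlg.cls_congr K _ (e.trans
      { toFun := fun _ => PUnit.unit
        invFun := fun _ i => i.elim
        left_inv := fun _ => funext fun i => i.elim
        map_rel_iff' := ⟨fun _ i => i.elim, fun _ => trivial⟩ }) _ _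
  | h_option ih =>
    rename_i ι _ _ _
    let Q : BddPoset :=
      letI : Fintype (∀ i : ι, SP (A (some i))) := Fintype.ofFinite _
      ⟨∀ i : ι, SP (A (some i))⟩
    have hQ : FamilyQ Q := ⟨ι, inferInstance, fun i => A (some i), fun _ => inferInstance,
      fun _ => inferInstance, ⟨OrderIso.refl _⟩⟩
    have := Fintype.ofFinite ι
    have hQ' := ih (fun i => A (some i)) Q hQ (OrderIso.refl _)
    rw [finprod_eq_prod_of_fintype] at hQ' ⊢
    rw [Fintype.prod_option, ← hQ', IncidenceAlg.cls_mul_cls]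
    exact IncidenceAlg.cls_congr K _
      (e.trans (optionPiOrderIso (α := fun i => (SP (A i) : Type)))) _ _

variable (K)

/-- The morphism of monoids from classes of posets to the Faà di Bruno algebra. -/
noncomputable def classValue : PosetClass familyQ_isHereditary →* FdB K where
  toFun := PosetClass.lift (fun _ hP => hP.value K) fun _ _ hP hQ e => hP.value_congr e hQ
  map_one' := FamilyQ.value_point
  map_mul' := by
    rintro ⟨P, hP⟩ ⟨Q, hQ⟩
    exact hP.value_prod hQ

/-- The morphism of algebras from `H(Q)` to the Faà di Bruno algebra. -/
noncomputable def HQ.toFdB : HQ K →ₐ[K] FdB K :=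
  show MonoidAlgebra K (PosetClass familyQ_isHereditary) →ₐ[K] FdB K from
    MonoidAlgebra.lift K (FdB K) _ (classValue K)

theorem HQ.toFdB_cls (P : BddPoset) (hP : FamilyQ P) :
    HQ.toFdB K (IncidenceAlg.cls K _ P hP) = hP.value K :=
  (MonoidAlgebra.lift_single (classValue K) _ (1 : K)).trans (one_smul _ _)

theorem HQ.toFdB_X (n : ℕ) : HQ.toFdB K (HQ.X K n) = ((n + 1)! : K) • FdB.x K n := by
  rw [HQ.X, HQ.toFdB_cls, FamilyQ.value_SP, Nat.card_fin]
  rfl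

/-- The morphism of algebras from the Faà di Bruno algebra to `H(Q)`. -/
noncomputable def FdB.toHQ : FdB K →ₐ[K] HQ K :=
  show MvPolynomial ℕ+ K →ₐ[K] HQ K from
    MvPolynomial.aeval fun n : ℕ+ => (((n : ℕ) + 1)! : K)⁻¹ • HQ.X K n

theorem FdB.x_zero : FdB.x K 0 = 1 := rfl

theorem FdB.x_pnat (n : ℕ+) : FdB.x K n = (MvPolynomial.X n : MvPolynomial ℕ+ K) := dif_pos n.pos

theorem FdB.algHom_ext {B : Type*} [Semiring B] [Algebra K B] {f g : FdB K →ₐ[K] B}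
    (hfg : ∀ n : ℕ+, f (FdB.x K n) = g (FdB.x K n)) : f = g :=
  MvPolynomial.algHom_ext (R := K) (σ := ℕ+) (A := B) (f := f) (g := g) fun n => by
    have h := hfg n
    rwa [FdB.x_pnat] at h

theorem HQ.X_zero : HQ.X K 0 = 1 :=
  IncidenceAlg.cls_of_card_eq_one K _ _ _ <| by
    rw [← Nat.card_eq_fintype_card, ← Nat.card_congr (setoidOrderIsoSP (Fin (0 + 1))).toEquiv,
      Nat.card_eq_one_iff_unique]
    have : Subsingleton (Fin (0 + 1)) := Fin.subsingleton_one
    exact ⟨⟨fun r s => Setoid.ext fun a b => by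
      rw [Subsingleton.elim a b]
      exact iff_of_true (r.refl _) (s.refl _)⟩, ⟨⊥⟩⟩

theorem FdB.toHQ_x (n : ℕ) : FdB.toHQ K (FdB.x K n) = ((n + 1)! : K)⁻¹ • HQ.X K n := by
  rcases Nat.eq_zero_or_pos n with rfl | hn
  · rw [HQ.X_zero, FdB.x_zero, map_one]
    simp
  · lift n to ℕ+ using hn
    rw [FdB.x_pnat]
    exact MvPolynomial.aeval_X _ _

variable [CharZero K]

theorem factorial_cast_ne_zero (n : ℕ) : (n ! : K) ≠ 0 :=
  Nat.cast_ne_zero.2 (Nat.factorial_ne_zero _)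

theorem HQ.toFdB_comp_toHQ : (HQ.toFdB K).comp (FdB.toHQ K) = AlgHom.id K _ :=
  FdB.algHom_ext K fun n => by
    rw [AlgHom.comp_apply, FdB.toHQ_x, map_smul, HQ.toFdB_X,
      inv_smul_smul₀ (factorial_cast_ne_zero K _), AlgHom.id_apply]

theorem FdB.toHQ_gen (A : Type) [Finite A] [Nonempty A] :
    FdB.toHQ K (FdB.gen K (Nat.card A)) = IncidenceAlg.cls K _ (SP A) (familyQ_SP A) := by
  -- The index shift is harmless because `A` is nonempty.
  have hA : Nat.card A - 1 + 1 = Nat.card A := Nat.succ_pred Nat.card_pos.ne'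
  rw [FdB.gen, map_smul, FdB.toHQ_x, hA, smul_inv_smul₀ (factorial_cast_ne_zero K _), HQ.X]
  have f : Fin (Nat.card A - 1 + 1) ≃ A := (finCongr hA).trans (Finite.equivFin A).symm
  have g : Setoid (Fin (Nat.card A - 1 + 1)) ≃o Setoid A :=
    { toFun := Setoid.comap f.symm
      invFun := Setoid.comap f
      left_inv := fun r => Setoid.ext fun a b => by simp [Setoid.comap_rel]
      right_inv := fun r => Setoid.ext fun a b => by simp [Setoid.comap_rel]
      map_rel_iff' := fun {r s} => ⟨fun h a b hab => by
        have : s (f.symm (f a)) (f.symm (f b)) :=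
          h (show r (f.symm (f a)) (f.symm (f b)) by simpa using hab)
        simpa using this, fun h a b hab => h hab⟩ }
  exact IncidenceAlg.cls_congr K _
    (((setoidOrderIsoSP _).symm.trans g).trans (setoidOrderIsoSP A)) _ _

theorem FdB.toHQ_comp_toFdB : (FdB.toHQ K).comp (HQ.toFdB K) = AlgHom.id K _ := by
  refine AlgHom.toLinearMap_injective (IncidenceAlg.linearMap_ext fun P hP => ?_)
  obtain ⟨ι, _, A, _, _, ⟨e⟩⟩ := id hP
  have := Fintype.ofFinite ι
  change FdB.toHQ K (HQ.toFdB K _) = _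
  rw [HQ.toFdB_cls, hP.value_eq e, finprod_eq_prod_of_fintype, map_prod]
  simp only [FdB.toHQ_gen]
  rw [← finprod_eq_prod_of_fintype]
  exact (cls_eq_finprod A P hP e).symm

/-- The isomorphism of algebras from `H(Q)` to the Faà di Bruno algebra. -/
noncomputable def HQ.equivFdB : HQ K ≃ₐ[K] FdB K :=
  AlgEquiv.ofAlgHom (HQ.toFdB K) (FdB.toHQ K) (HQ.toFdB_comp_toHQ K) (FdB.toHQ_comp_toFdB K)


end Iso

/-! ### Compatibility of the isomorphism with coproduct and counit. -/

section Comul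

open scoped Nat
open BddPoset

/-- Refining `S` means partitioning each of its blocks independently. -/
theorem FamilyQ.value_interval_bot {K : Type*} [Field K] (A : Type) [Finite A] (S : Setoid A)
    (hP : FamilyQ ((SP A).interval ⊥ (setoidOrderIsoSP A S) bot_le)) :
    hP.value K = ∏ᶠ W : Quotient S, FdB.gen K (Nat.card {a // Quotient.mk S a = W}) := by
  let e : (SP A).interval ⊥ (setoidOrderIsoSP A S) bot_le ≃o Set.Iic S :=
    { toFun := fun z => ⟨(setoidOrderIsoSP A).symm (intervalVal z),
        (setoidOrderIsoSP A).symm_apply_le.2 z.2.2⟩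
      invFun := fun T => intervalMk bot_le (setoidOrderIsoSP A T.1) bot_le
        ((setoidOrderIsoSP A).monotone T.2)
      left_inv := fun z => Subtype.ext ((setoidOrderIsoSP A).apply_symm_apply _)
      right_inv := fun T => Subtype.ext ((setoidOrderIsoSP A).symm_apply_apply _)
      map_rel_iff' := fun {z w} =>
        (setoidOrderIsoSP A).symm.le_iff_le (x := intervalVal z) (y := intervalVal w) }
  have : ∀ W : Quotient S, Nonempty {a // Quotient.mk S a = W} := by
    rintro ⟨a⟩
    exact ⟨a, rfl⟩
  exact hP.value_eq ((e.trans (setoidIicIso S)).trans (orderIsoPi fun W => setoidOrderIsoSP _))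

/-- Coarsening `S` means partitioning the set of its blocks. -/
theorem FamilyQ.value_interval_top {K : Type*} [Field K] (A : Type) [Finite A] [Nonempty A]
    (S : Setoid A) (hP : FamilyQ ((SP A).interval (setoidOrderIsoSP A S) ⊤ le_top)) :
    hP.value K = FdB.gen K (Nat.card (Quotient S)) := by
  let e : (SP A).interval (setoidOrderIsoSP A S) ⊤ le_top ≃o {T : Setoid A // S ≤ T} :=
    { toFun := fun z => ⟨(setoidOrderIsoSP A).symm (intervalVal z),
        (setoidOrderIsoSP A).le_symm_apply.2 z.2.1⟩
      invFun := fun T => intervalMk le_top (setoidOrderIsoSP A T.1)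
        ((setoidOrderIsoSP A).monotone T.2) le_top
      left_inv := fun z => Subtype.ext ((setoidOrderIsoSP A).apply_symm_apply _)
      right_inv := fun T => Subtype.ext ((setoidOrderIsoSP A).symm_apply_apply _)
      map_rel_iff' := fun {z w} =>
        (setoidOrderIsoSP A).symm.le_iff_le (x := intervalVal z) (y := intervalVal w) }
  have : Nonempty (Quotient S) := ‹Nonempty A›.map (Quotient.mk S)
  rw [hP.value_congr ((e.trans (Setoid.correspondence S)).trans (setoidOrderIsoSP _))
    (familyQ_SP _), FamilyQ.value_SP]

variable (K : Type*) [Field K]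

theorem FdB.comul_x (n : ℕ+) : FdB.comul K (FdB.x K n) =
    ∑ m ∈ Finset.range (n + 1), (((m + 1)! : K) / (((n : ℕ) + 1)! : K)) •
      (bellPoly K (n + 1) (m + 1) (FdB.gen K) ⊗ₜ[K] FdB.x K m) := by
  rw [FdB.x_pnat]
  exact MvPolynomial.aeval_X _ _

variable [CharZero K]

/-- The coproduct of the class of a partition lattice, as a sum over the numbers of blocks. -/
theorem map_toFdB_comul_X (n : ℕ) :
    TensorProduct.map (HQ.toFdB K).toLinearMap (HQ.toFdB K).toLinearMap
        (IncidenceAlg.comul K _ (HQ.X K n)) =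
      ∑ m ∈ Finset.range (n + 1),
        bellPoly K (n + 1) (m + 1) (FdB.gen K) ⊗ₜ[K] FdB.gen K (m + 1) := by
  classical
  let ψ := setoidOrderIsoSP (Fin (n + 1))
  have : Finite (Setoid (Fin (n + 1))) := Finite.of_equiv _ ψ.symm.toEquiv
  have : Fintype (Setoid (Fin (n + 1))) := Fintype.ofFinite _
  have : ∀ S : Setoid (Fin (n + 1)), Fintype (Quotient S) := fun S => Fintype.ofFinite _
  rw [HQ.X, IncidenceAlg.comul_cls, IncidenceAlg.comulPoset, map_sum,
    ← ψ.toEquiv.sum_comp]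
  have h1 (S : Setoid (Fin (n + 1))) :
      TensorProduct.map (HQ.toFdB K).toLinearMap (HQ.toFdB K).toLinearMap
        (IncidenceAlg.cls K familyQ_isHereditary ((SP (Fin (n + 1))).interval ⊥ (ψ S) bot_le)
            (familyQ_isHereditary.interval _ _ _ _ (familyQ_SP _)) ⊗ₜ[K]
          IncidenceAlg.cls K familyQ_isHereditary ((SP (Fin (n + 1))).interval (ψ S) ⊤ le_top)
            (familyQ_isHereditary.interval _ _ _ _ (familyQ_SP _))) =
        (∏ W : Quotient S, FdB.gen K (Nat.card {a // Quotient.mk S a = W})) ⊗ₜ[K]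
          FdB.gen K (Nat.card (Quotient S)) := by
    rw [TensorProduct.map_tmul, AlgHom.toLinearMap_apply, AlgHom.toLinearMap_apply,
      HQ.toFdB_cls, HQ.toFdB_cls, FamilyQ.value_interval_bot, FamilyQ.value_interval_top,
      finprod_eq_prod_of_fintype]
  refine (Fintype.sum_congr _ _ h1).trans ?_
  have hmem (S : Setoid (Fin (n + 1))) (_ : S ∈ Finset.univ) :
      Nat.card (Quotient S) - 1 ∈ Finset.range (n + 1) := by
    have h2 := Nat.card_le_card_of_surjective (Quotient.mk S) Quotient.mk_surjective
    rw [Nat.card_fin] at h2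
    exact Finset.mem_range.2 (by omega)
  -- The summand `m` collects the partitions with m + 1 blocks, whose upper interval has class X_m.
  rw [← Finset.sum_fiberwise_of_maps_to hmem]
  refine Finset.sum_congr rfl fun m hm => ?_
  have hb := sum_setoid_eq_bellPoly K (α := Fin (n + 1)) (m := m + 1)
    (by rw [Fintype.card_fin]; exact Finset.mem_range.1 hm) (FdB.gen K)
  rw [Fintype.card_fin] at hb
  rw [← hb, TensorProduct.sum_tmul]
  refine Finset.sum_congr (Finset.filter_congr fun S _ => ?_) fun S hS => ?_
  · have : 0 < Nat.card (Quotient S) := Nat.card_pos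
    omega
  · rw [(Finset.mem_filter.1 hS).2]

theorem HQ.toFdB_comul (a : HQ K) :
    FdB.comul K (HQ.toFdB K a) =
      TensorProduct.map (HQ.toFdB K).toLinearMap (HQ.toFdB K).toLinearMap
        (IncidenceAlg.comul K _ a) := by
  let ΔQ : HQ K →ₐ[K] HQ K ⊗[K] HQ K := AlgHom.ofLinearMap (IncidenceAlg.comul K _)
    (IncidenceAlg.comul_one K _) (IncidenceAlg.comul_mul K _)
  -- Composed with `FdB.toHQ`, both sides are algebra morphisms on a polynomial algebra, so the
  -- generators x_n suffice.
  have h : (FdB.comul K).comp ((HQ.toFdB K).comp (FdB.toHQ K)) =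
      ((Algebra.TensorProduct.map (HQ.toFdB K) (HQ.toFdB K)).comp ΔQ).comp (FdB.toHQ K) := by
    rw [HQ.toFdB_comp_toHQ]
    refine FdB.algHom_ext K fun n => ?_
    rw [AlgHom.comp_apply, AlgHom.comp_apply, FdB.toHQ_x, map_smul, AlgHom.id_apply, FdB.comul_x]
    refine Eq.trans ?_ (congrArg _ (map_toFdB_comul_X K n).symm)
    rw [Finset.smul_sum]
    refine Finset.sum_congr rfl fun m _ => ?_
    -- The coefficient (m+1)!/(n+1)! combines x_n ↦ X_n/(n+1)! on the way in with X_m ↦ (m+1)! x_m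
    -- on the way out.
    rw [FdB.gen, TensorProduct.tmul_smul, smul_smul, div_eq_inv_mul]
    rfl
  obtain ⟨b, rfl⟩ := (HQ.equivFdB K).symm.surjective a
  exact DFunLike.congr_fun h b

theorem HQ.toFdB_counit (a : HQ K) :
    FdB.counit K (HQ.toFdB K a) = IncidenceAlg.counit K _ a := by
  let εQ : HQ K →ₐ[K] K := AlgHom.ofLinearMap (IncidenceAlg.counit K _)
    (IncidenceAlg.counit_one K _) (IncidenceAlg.counit_mul K _)
  have h : (FdB.counit K).comp ((HQ.toFdB K).comp (FdB.toHQ K)) = εQ.comp (FdB.toHQ K) := by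
    rw [HQ.toFdB_comp_toHQ]
    refine FdB.algHom_ext K fun n => ?_
    rw [AlgHom.comp_apply, AlgHom.comp_apply, FdB.toHQ_x, map_smul, AlgHom.id_apply]
    have h0 : IncidenceAlg.counit K familyQ_isHereditary (HQ.X K n) = 0 := by
      rw [HQ.X, IncidenceAlg.counit_cls, IncidenceAlg.counitPoset, if_neg]
      intro hc
      have h1 := Fintype.card_le_one_iff_subsingleton.1 hc.le
      have h2 : (⊥ : Setoid (Fin (n + 1))) = ⊤ :=
        (setoidOrderIsoSP (Fin (n + 1))).injective (Subsingleton.elim _ _)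
      -- As n ≥ 1, the set has two distinct points, so ⊥ ≠ ⊤ and the lattice is not a single point.
      have h3 : (0 : Fin (n + 1)) = Fin.last n := Setoid.eq_top_iff.1 h2 0 (Fin.last n)
      exact n.ne_zero (congrArg Fin.val h3).symm
    change _ = _ • IncidenceAlg.counit K familyQ_isHereditary (HQ.X K n)
    rw [h0, smul_zero, FdB.x_pnat]
    exact MvPolynomial.aeval_X _ _
  obtain ⟨b, rfl⟩ := (HQ.equivFdB K).symm.surjective a
  exact DFunLike.congr_fun h b

end Comul

theorem mainTheorem6 (K : Type*) [Field K] [CharZero K] :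
    ∃ (hQ : IsHopf (IncidenceAlg.comul K familyQ_isHereditary)
        (IncidenceAlg.counit K familyQ_isHereditary))
      (hF : IsHopf (FdB.comul K).toLinearMap (FdB.counit K).toLinearMap),
      letI := hQ.hopfAlgebra
      letI := hF.hopfAlgebra
      ∃ e : HQ K ≃ₐc[K] FdB K, ∀ n : ℕ, e (HQ.X K n) = (Nat.factorial (n + 1) : K) • FdB.x K n := by
  have hQ := IncidenceAlg.isHopf K familyQ_isHereditary
  have hF : IsHopf (FdB.comul K).toLinearMap (FdB.counit K).toLinearMap :=
    hQ.of_algEquiv (HQ.equivFdB K) (HQ.toFdB_comul K) (HQ.toFdB_counit K)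
  refine ⟨hQ, hF, ?_⟩
  let := hQ.hopfAlgebra
  let := hF.hopfAlgebra
  refine ⟨BialgEquiv.ofAlgEquiv (HQ.equivFdB K) ?_ ?_, HQ.toFdB_X K⟩
  · exact AlgHom.ext (HQ.toFdB_counit K)
  · exact AlgHom.ext fun a => (HQ.toFdB_comul K a).symm
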